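/- \textbf{Definitions.} Let $G$ be a subgroup of $GL(d_0,\mathbb R)$. A \emph{periodic cocycle} in $G$ with period $\ell\ge 1$ is a sequence $(A_i)_{i\in\mathbb Z}$ in $G$ with $A_{i+\ell}=A_i$ for all $i$ ($\ell$ need not be minimal). It is \emph{hyperbolic} if $\mathcal A:=A_\ell\cdots A_1$ has no (complex) eigenvalue on the unit circle. It is \emph{bounded by $C$} if $\max(\|A_i\|,\|A_i^{-1}\|)\le C$ for $1\le i\le \ell$, where $\|\cdot\|$ is the operator norm associated with the Euclidean norm. An \emph{$\varepsilon$-path of perturbations with the same period} is a family $(A_i(t))_{i\in\mathbb Z}$, $t\in[0,1]$, of periodic cocycles in $G$ with period $\ell$ such that each $t\mapsto A_i(t)$ is continuous, $A_i(0)=A_i$, and $\max(\|A_i-A_i(t)\|,\|A_i^{-1}-A_i(t)^{-1}\|)<\varepsilon$ for all $i$ and all $t\in[0,1]$. For even $d_0=2d$, $Sp(d_0,\mathbb R)$ is the group of real matrices preserving the standard symplectic form on $\mathbb R^{2d}$. \textbf{Proposition (Real eigenvalues).} For any $d_0\ge 1$, $C>1$ and $\varepsilon>0$, there exists $T\ge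 1$ with the following property. Any periodic cocycle in $GL(d_0,\mathbb R)$ or $SL(d_0,\mathbb R)$ bounded by $C$ and with period $\ell\ge T$ admits an $\varepsilon$-path of perturbations $(A_i(t))_{t\in[0,1]}$ with the same period $\ell$, in the same group ($GL(d_0,\mathbb R)$, respectively $SL(d_0,\mathbb R)$), such that \begin{itemize} \item the moduli of the eigenvalues of $\mathcal A(t):=A_\ell(t)\cdots A_1(t)$, counted with multiplicity, are constant in $t\in[0,1]$; \item $\mathcal A(1)$ has only real eigenvalues. \end{itemize} If $d_0\geq 2$ is even, the same result holds in $Sp(d_0,\mathbb R)$ (with the perturbations in $Sp(d_0,\mathbb R)$) for hyperbolic periodic cocycles: there exists $T\ge 1$, depending only on $d_0,C,\varepsilon$, such that any hyperbolic periodic cocycle in $Sp(d_0,\mathbb R)$ bounded by $C$ and with period $\ell\ge T$ admits an $\varepsilon$-path of perturbations in $Sp(d_0,\mathbb R)$ with the same period and these two properties. -/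

import Mathlib

open scoped Matrix.Norms.L2Operator

/-- The special linear group `SL(n, ℝ)`, as a subgroup of `GL(n, ℝ)`. -/
def slSubgroup (n : Type*) [Fintype n] [DecidableEq n] :
    Subgroup (Matrix.GeneralLinearGroup n ℝ) :=
  (Matrix.GeneralLinearGroup.det (n := n) (R := ℝ)).ker

/-- The symplectic group `Sp(2d, ℝ)`, as a subgroup of `GL(2d, ℝ)`: the image of the group
of symplectic matrices. The coordinates of `ℝ^{2d} = ℝ^d × ℝ^d` are indexed by
`Fin d ⊕ Fin d`. -/
def spSubgroup (d : ℕ) : Subgroup (Matrix.GeneralLinearGroup (Fin d ⊕ Fin d) ℝ) :=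
  (MonoidHom.toHomUnits (Matrix.symplecticGroup (Fin d) ℝ).subtype).range

/-- The complex eigenvalues of a real matrix, counted with algebraic multiplicity. -/
noncomputable def complexEigenvalues {n : Type*} [Fintype n] [DecidableEq n]
    (M : Matrix n n ℝ) : Multiset ℂ :=
  (M.map (algebraMap ℝ ℂ)).charpoly.roots

/-- A periodic cocycle in `G` with (not necessarily minimal) period `ℓ ≥ 1`: a sequence
`(A i)_{i ∈ ℤ}` of elements of `G` such that `A (i + ℓ) = A i`. -/
structure PeriodicCocycle {n : Type*} [Fintype n] [DecidableEq n]
    (G : Subgroup (Matrix.GeneralLinearGroup n ℝ)) (ℓ : ℕ) where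
  /-- the sequence of matrices -/
  toFun : ℤ → Matrix.GeneralLinearGroup n ℝ
  one_le_period : 1 ≤ ℓ
  mem : ∀ i, toFun i ∈ G
  periodic : ∀ i, toFun (i + ℓ) = toFun i

/-- The product `A k * ⋯ * A 2 * A 1` (equal to `1` for `k = 0`). -/
def orderedProd {n : Type*} [Fintype n] [DecidableEq n]
    (A : ℤ → Matrix.GeneralLinearGroup n ℝ) : ℕ → Matrix.GeneralLinearGroup n ℝ
  | 0 => 1
  | k + 1 => A ((k : ℤ) + 1) * orderedProd A k

namespace PeriodicCocycle

/-- The product over one period, `A ℓ * ⋯ * A 1`. -/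
def product {n : Type*} [Fintype n] [DecidableEq n]
    {G : Subgroup (Matrix.GeneralLinearGroup n ℝ)} {ℓ : ℕ} (A : PeriodicCocycle G ℓ) :
    Matrix n n ℝ :=
  (orderedProd A.toFun ℓ).val

/-- The cocycle is hyperbolic: its product has no eigenvalue on the unit circle. -/
def IsHyperbolic {n : Type*} [Fintype n] [DecidableEq n]
    {G : Subgroup (Matrix.GeneralLinearGroup n ℝ)} {ℓ : ℕ} (A : PeriodicCocycle G ℓ) : Prop :=
  ∀ z ∈ complexEigenvalues A.product, ‖z‖ ≠ 1

/-- The cocycle is bounded by `C`, in the operator norm for the Euclidean norm. -/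
def IsBoundedBy {n : Type*} [Fintype n] [DecidableEq n]
    {G : Subgroup (Matrix.GeneralLinearGroup n ℝ)} {ℓ : ℕ} (A : PeriodicCocycle G ℓ)
    (C : ℝ) : Prop :=
  ∀ i : ℤ, 1 ≤ i → i ≤ ℓ → max ‖(A.toFun i).val‖ ‖((A.toFun i)⁻¹).val‖ ≤ C

/-- An `ε`-path of perturbations of the cocycle `A`, with the same period and in the same
group: a continuous family of cocycles starting at `A` whose matrices and their inverses
stay `ε`-close to those of `A`. -/
structure IsPathOfPerturbations {n : Type*} [Fintype n] [DecidableEq n]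
    {G : Subgroup (Matrix.GeneralLinearGroup n ℝ)} {ℓ : ℕ} (A : PeriodicCocycle G ℓ)
    (ε : ℝ) (γ : unitInterval → PeriodicCocycle G ℓ) : Prop where
  continuous : ∀ i, Continuous fun t => ((γ t).toFun i).val
  start : γ 0 = A
  close : ∀ t i, max ‖(A.toFun i).val - ((γ t).toFun i).val‖
    ‖((A.toFun i)⁻¹).val - (((γ t).toFun i)⁻¹).val‖ < ε

/-- The cocycle `A` admits an `ε`-path of perturbations in `G`, with the same period, along
which the moduli of the eigenvalues of the product (with multiplicity) are constant, and at
the end of which the product has only real eigenvalues. -/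
def CanBeMadeReal {n : Type*} [Fintype n] [DecidableEq n]
    {G : Subgroup (Matrix.GeneralLinearGroup n ℝ)} {ℓ : ℕ} (A : PeriodicCocycle G ℓ)
    (ε : ℝ) : Prop :=
  ∃ γ : unitInterval → PeriodicCocycle G ℓ, A.IsPathOfPerturbations ε γ ∧
    (∀ s t, (complexEigenvalues (γ s).product).map (fun z => ‖z‖) =
      (complexEigenvalues (γ t).product).map (fun z => ‖z‖)) ∧
    ∀ z ∈ complexEigenvalues (γ 1).product, z.im = 0

end PeriodicCocycle

/-! Every perturbation has the form `A i * D t i` with `D t i` a rotation close to the identity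
(`IsRotationPath`). Determinants are untouched, and closeness costs only a factor `C`.

In the plane, turn every factor by an angle `±α`, the sign following the orientation of the partial
product. While the eigenvalues `√Δ e^{±iθ}` are not real, all factors push `θ` in the same
direction, each with speed at least 1. So they become real for some `α ≤ π / ℓ`
(`exists_discr_nonneg`). Until the first such `α` both moduli equal `√Δ`, which is constant.

In dimension at least 3, the product has a proper nonzero invariant subspace, because real
irreducible polynomials have degree at most 2. Orthonormal frames adapted to its successive images
make the sequence block triangular. Rotation paths for the diagonal blocks combine without loss in
`ε` or `ℓ`, since frames are orthogonal and a block-diagonal norm is bounded by the larger of the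
block norms (`isRotationPath_blockConj`). Induction on the dimension gives `exists_isRotationPath`.

For a hyperbolic symplectic product the invariant subspace can be taken Lagrangian
(`exists_lagrangian_invariant`), with frames commuting with `J`. The diagonal blocks are then
inverse transposes of each other, and one rotation path serves both. -/

/-! ### Complex eigenvalues under conjugation, block triangularity and inversion -/

section Eigenvalues

variable {n m : Type*} [Fintype n] [DecidableEq n] [Fintype m] [DecidableEq m]

theorem complexEigenvalues_eq_roots_map (M : Matrix n n ℝ) :
    complexEigenvalues M = (M.charpoly.map (algebraMap ℝ ℂ)).roots := by
  rw [complexEigenvalues, Matrix.charpoly_map]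

/-- Cyclic invariance of the characteristic polynomial. The two index types differ because frames
are indexed by a sum type. -/
theorem complexEigenvalues_conj (Q : Matrix n m ℝ) (h₁ : Q.transpose * Q = 1)
    (h₂ : Q * Q.transpose = 1) (N : Matrix m m ℝ) :
    complexEigenvalues (Q * N * Q.transpose) = complexEigenvalues N := by
  have hc : Fintype.card n = Fintype.card m :=
    Matrix.square_of_invertible Q Q.transpose h₂ h₁
  have h := Matrix.charpoly_mul_comm_of_le (Q * N) Q.transpose hc.ge
  rw [← Matrix.mul_assoc, h₁, Matrix.one_mul, hc, Nat.sub_self, pow_zero, one_mul] at h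
  rw [complexEigenvalues_eq_roots_map, complexEigenvalues_eq_roots_map, h]

theorem complexEigenvalues_fromBlocks (A : Matrix n n ℝ) (B : Matrix n m ℝ) (D : Matrix m m ℝ) :
    complexEigenvalues (Matrix.fromBlocks A B 0 D) =
      complexEigenvalues A + complexEigenvalues D := by
  simp only [complexEigenvalues_eq_roots_map]
  rw [Matrix.charpoly_fromBlocks_zero₂₁, Polynomial.map_mul, Polynomial.roots_mul]
  rw [← Polynomial.map_mul]
  exact (((Matrix.charpoly_monic A).mul (Matrix.charpoly_monic D)).map _).ne_zero

theorem complexEigenvalues_transpose (M : Matrix n n ℝ) :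
    complexEigenvalues M.transpose = complexEigenvalues M := by
  simp only [complexEigenvalues_eq_roots_map, Matrix.charpoly_transpose]

theorem ne_zero_of_mem_complexEigenvalues {M : Matrix n n ℝ} (hM : IsUnit M) {z : ℂ}
    (hz : z ∈ complexEigenvalues M) : z ≠ 0 := by
  rintro rfl
  rw [complexEigenvalues_eq_roots_map, Polynomial.mem_roots
    ((Matrix.charpoly_monic M).map _).ne_zero, Polynomial.IsRoot, Polynomial.eval_zero_map] at hz
  have h := Matrix.det_eq_sign_charpoly_coeff M
  rw [← Polynomial.coeff_zero_eq_eval_zero] at hz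
  have h0 : M.charpoly.coeff 0 = 0 := by simpa using hz
  rw [h0, mul_zero] at h
  exact ((Matrix.isUnit_iff_isUnit_det M).1 hM).ne_zero h

/-- For `x ≠ 0`, `det N * χ_{N⁻¹}(x) = det (-x (x⁻¹ - N))`, and the right side factors over the
eigenvalues of `N`. Agreement off 0 is enough for polynomials. This serves the second diagonal block
in the symplectic case. -/
theorem complexEigenvalues_inv (M : Matrix n n ℝ) (hM : IsUnit M) :
    complexEigenvalues M⁻¹ = (complexEigenvalues M).map (fun z => z⁻¹) := by
  set N : Matrix n n ℂ := M.map (algebraMap ℝ ℂ) with hN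
  have hNM : N * (M⁻¹).map (algebraMap ℝ ℂ) = 1 := by
    rw [hN, ← Matrix.map_mul, Matrix.mul_nonsing_inv _ ((Matrix.isUnit_iff_isUnit_det M).1 hM)]
    simp
  have hinv : (M⁻¹).map (algebraMap ℝ ℂ) = N⁻¹ := (Matrix.inv_eq_right_inv hNM).symm
  have hNu : IsUnit N := IsUnit.of_mul_eq_one _ hNM
  have hNd : N.det ≠ 0 := ((Matrix.isUnit_iff_isUnit_det N).1 hNu).ne_zero
  have hsplit : N.charpoly.Splits := IsAlgClosed.splits _
  have hp : N.charpoly = ((complexEigenvalues M).map fun a => Polynomial.X - Polynomial.C a).prod :=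
    hsplit.eq_prod_roots_of_monic N.charpoly_monic
  have key : (N⁻¹).charpoly =
      ((complexEigenvalues M).map fun a => Polynomial.X - Polynomial.C a⁻¹).prod := by
    apply Polynomial.eq_of_infinite_eval_eq
    refine Set.Infinite.mono ?_ (Set.Finite.infinite_compl (Set.finite_singleton (0 : ℂ)))
    intro x hx
    have hx : x ≠ 0 := hx
    have hcard : (complexEigenvalues M).card = Fintype.card n := by
      rw [complexEigenvalues, ← hsplit.natDegree_eq_card_roots, Matrix.charpoly_natDegree_eq_dim]
    have hdet : N.det = (complexEigenvalues M).prod := Matrix.det_eq_prod_roots_charpoly N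
    apply mul_left_cancel₀ hNd
    calc N.det * (N⁻¹).charpoly.eval x
        = (N * (Matrix.scalar n x - N⁻¹)).det := by rw [Matrix.eval_charpoly, Matrix.det_mul]
      _ = ((-x) • (Matrix.scalar n x⁻¹ - N)).det := by
          congr 1
          rw [mul_sub, Matrix.mul_nonsing_inv _ ((Matrix.isUnit_iff_isUnit_det N).1 hNu), smul_sub,
            Matrix.scalar_apply, Matrix.scalar_apply, ← Matrix.smul_one_eq_diagonal,
            ← Matrix.smul_one_eq_diagonal, smul_smul, neg_mul, mul_inv_cancel₀ hx]
          simp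
          abel
      _ = ((complexEigenvalues M).map fun a => -x * (x⁻¹ - a)).prod := by
          rw [Matrix.det_smul, ← Matrix.eval_charpoly, hp, Polynomial.eval_multiset_prod,
            Multiset.map_map, Multiset.prod_map_mul, Multiset.map_const', Multiset.prod_replicate,
            hcard]
          simp
      _ = ((complexEigenvalues M).map fun a => a * (x - a⁻¹)).prod := by
          congr 1
          refine Multiset.map_congr rfl fun a ha => ?_
          have := ne_zero_of_mem_complexEigenvalues hM ha
          field_simp
          ring
      _ = _ := by
          rw [Multiset.prod_map_mul, Multiset.map_id', ← hdet, Polynomial.eval_multiset_prod,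
            Multiset.map_map]
          simp
  rw [complexEigenvalues, hinv, key]
  have : ((complexEigenvalues M).map fun a => Polynomial.X - Polynomial.C a⁻¹) =
    ((complexEigenvalues M).map (fun z => z⁻¹)).map fun a => Polynomial.X - Polynomial.C a := by
      simp
  rw [this, Polynomial.roots_multiset_prod_X_sub_C]

end Eigenvalues

/-! ### Products of sequences of matrices -/

/-- The product `S (k - 1) * ⋯ * S 1 * S 0` of the first `k` matrices of a sequence. -/
def matProd {n : Type*} [Fintype n] [DecidableEq n] (S : ℕ → Matrix n n ℝ) : ℕ → Matrix n n ℝ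
  | 0 => 1
  | k + 1 => S k * matProd S k

section Products

variable {n m : Type*} [Fintype n] [DecidableEq n] [Fintype m] [DecidableEq m]

theorem matProd_det (S : ℕ → Matrix n n ℝ) (k : ℕ) :
    (matProd S k).det = ∏ i ∈ Finset.range k, (S i).det := by
  induction k with
  | zero => simp [matProd]
  | succ k ih => rw [matProd, Matrix.det_mul, ih, Finset.prod_range_succ, mul_comm]

/-- A change of coordinates along a sequence of orthogonal frames. -/
theorem matProd_frames {S : ℕ → Matrix n n ℝ} {N : ℕ → Matrix m m ℝ} {Q : ℕ → Matrix n m ℝ}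
    (hQ : ∀ i, Q i * (Q i).transpose = 1) {k : ℕ}
    (h : ∀ i < k, S i = Q (i + 1) * N i * (Q i).transpose)
    (hQ' : ∀ i, (Q i).transpose * Q i = 1) :
    matProd S k = Q k * matProd N k * (Q 0).transpose := by
  induction k with
  | zero => simp [matProd, hQ]
  | succ k ih =>
    rw [matProd, ih fun i hi => h i (by omega), h k (by omega), matProd]
    calc _ = Q (k + 1) * N k * ((Q k).transpose * Q k) * (matProd N k * (Q 0).transpose) := by
          simp only [Matrix.mul_assoc]
      _ = _ := by rw [hQ']; simp only [Matrix.mul_assoc, Matrix.one_mul]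

theorem matProd_fromBlocks (A : ℕ → Matrix n n ℝ) (B : ℕ → Matrix n m ℝ) (D : ℕ → Matrix m m ℝ)
    (k : ℕ) : ∃ B', matProd (fun i => Matrix.fromBlocks (A i) (B i) 0 (D i)) k =
      Matrix.fromBlocks (matProd A k) B' 0 (matProd D k) := by
  induction k with
  | zero => exact ⟨0, by simp [matProd]⟩
  | succ k ih =>
    obtain ⟨B', h⟩ := ih
    exact ⟨A k * B' + B k * matProd D k, by
      rw [matProd, h, Matrix.fromBlocks_multiply]; simp [matProd]⟩

end Products

/-! ### Rotation paths -/

/-- A path `D` of families of rotations, `ε`-close to the identity, such that the product of the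
matrices `S i * D t i` has eigenvalues of constant moduli, which are real for `t = 1`. -/
structure IsRotationPath {n : Type*} [Fintype n] [DecidableEq n] (ε : ℝ) (ℓ : ℕ)
    (S : ℕ → Matrix n n ℝ) (D : unitInterval → ℕ → Matrix n n ℝ) : Prop where
  continuous : ∀ i, Continuous fun t => D t i
  start : ∀ i, D 0 i = 1
  orthogonal : ∀ t i, (D t i).transpose * D t i = 1
  det_eq_one : ∀ t i, (D t i).det = 1
  close : ∀ t i, ‖D t i - 1‖ ≤ ε
  norm_eq : ∀ t, (complexEigenvalues (matProd (fun i => S i * D t i) ℓ)).map (fun z => ‖z‖) =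
    (complexEigenvalues (matProd S ℓ)).map (fun z => ‖z‖)
  real : ∀ z ∈ complexEigenvalues (matProd (fun i => S i * D 1 i) ℓ), z.im = 0

theorem isRotationPath_one {n : Type*} [Fintype n] [DecidableEq n] {ε : ℝ} (hε : 0 ≤ ε) {ℓ : ℕ}
    {S : ℕ → Matrix n n ℝ} (h : ∀ z ∈ complexEigenvalues (matProd S ℓ), z.im = 0) :
    IsRotationPath ε ℓ S (fun _ _ => 1) where
  continuous _ := continuous_const
  start _ := rfl
  orthogonal _ _ := by simp
  det_eq_one _ _ := by simp
  close _ _ := by simpa using hε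
  norm_eq _ := by simp
  real := by simpa using h

/-! ### The planar case -/

section Planar

/-- The quarter turn of the plane. -/
def quarterTurn : Matrix (Fin 2) (Fin 2) ℝ := !![0, -1; 1, 0]

/-- The rotation of the plane of angle `θ`. -/
noncomputable def planeRotation (θ : ℝ) : Matrix (Fin 2) (Fin 2) ℝ :=
  !![Real.cos θ, -Real.sin θ; Real.sin θ, Real.cos θ]

theorem planeRotation_eq (θ : ℝ) :
    planeRotation θ = Real.cos θ • (1 : Matrix (Fin 2) (Fin 2) ℝ) + Real.sin θ • quarterTurn := by
  ext i j; fin_cases i <;> fin_cases j <;> simp [planeRotation, quarterTurn]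

theorem planeRotation_zero : planeRotation 0 = 1 := by simp [planeRotation_eq]

theorem det_planeRotation (θ : ℝ) : (planeRotation θ).det = 1 := by
  simp [planeRotation, Matrix.det_fin_two_of, ← sq]

theorem planeRotation_transpose_mul_self (θ : ℝ) :
    (planeRotation θ).transpose * planeRotation θ = 1 := by
  ext i j
  fin_cases i <;> fin_cases j <;>
    simp [planeRotation, Matrix.mul_apply, Fin.sum_univ_two] <;>
    nlinarith [Real.sin_sq_add_cos_sq θ]

theorem hasDerivAt_planeRotation (θ : ℝ) :
    HasDerivAt planeRotation (planeRotation θ * quarterTurn) θ := by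
  have h := ((Real.hasDerivAt_cos θ).smul_const (1 : Matrix (Fin 2) (Fin 2) ℝ)).add
    ((Real.hasDerivAt_sin θ).smul_const quarterTurn)
  have h1 : planeRotation = (fun θ => Real.cos θ • (1 : Matrix (Fin 2) (Fin 2) ℝ)) +
      fun θ => Real.sin θ • quarterTurn := funext planeRotation_eq
  rw [← h1] at h
  refine h.congr_deriv ?_
  ext i j
  fin_cases i <;> fin_cases j <;> simp [planeRotation, quarterTurn, Matrix.mul_apply]

theorem continuous_planeRotation : Continuous planeRotation :=
  continuous_iff_continuousAt.2 fun θ => (hasDerivAt_planeRotation θ).continuousAt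

/-- `(R - 1)ᵀ (R - 1)` is the scalar `2 - 2 cos θ`, at most `θ²`; the C⋆-identity turns this into a
norm bound. -/
theorem norm_planeRotation_sub_one_le (θ : ℝ) : ‖planeRotation θ - 1‖ ≤ |θ| := by
  have h : ‖planeRotation θ - 1‖ * ‖planeRotation θ - 1‖ = 2 - 2 * Real.cos θ := by
    rw [← Matrix.l2_opNorm_conjTranspose_mul_self]
    have : (planeRotation θ - 1).conjTranspose * (planeRotation θ - 1) =
        Matrix.diagonal fun _ => 2 - 2 * Real.cos θ := by
      ext i j
      fin_cases i <;> fin_cases j <;>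
        simp [planeRotation, Matrix.mul_apply, Fin.sum_univ_two, Matrix.conjTranspose] <;>
        nlinarith [Real.sin_sq_add_cos_sq θ]
    rw [this, Matrix.l2_opNorm_diagonal, pi_norm_const, Real.norm_eq_abs, abs_of_nonneg]
    linarith [Real.cos_le_one θ]
  refine abs_le_of_sq_le_sq' ?_ (abs_nonneg _) |>.2
  rw [sq, h, sq_abs]
  linarith [Real.one_sub_sq_div_two_le_cos (x := θ)]

theorem mem_complexEigenvalues_fin_two {M : Matrix (Fin 2) (Fin 2) ℝ} {z : ℂ} :
    z ∈ complexEigenvalues M ↔ z ^ 2 - M.trace * z + M.det = 0 := by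
  rw [complexEigenvalues_eq_roots_map,
    Polynomial.mem_roots ((Matrix.charpoly_monic M).map _).ne_zero, Matrix.charpoly_fin_two]
  simp

theorem card_complexEigenvalues {n : Type*} [Fintype n] [DecidableEq n] (M : Matrix n n ℝ) :
    (complexEigenvalues M).card = Fintype.card n := by
  rw [complexEigenvalues, ← (IsAlgClosed.splits _).natDegree_eq_card_roots,
    Matrix.charpoly_natDegree_eq_dim]

theorem im_eq_zero_of_mem_complexEigenvalues {M : Matrix (Fin 2) (Fin 2) ℝ}
    (h : 4 * M.det ≤ M.trace ^ 2) {z : ℂ} (hz : z ∈ complexEigenvalues M) : z.im = 0 := by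
  rw [mem_complexEigenvalues_fin_two] at hz
  have h1 := congrArg Complex.re hz
  have h2 := congrArg Complex.im hz
  simp [sq] at h1 h2
  have h3 : z.im * (2 * z.re - M.trace) = 0 := by linarith
  rcases mul_eq_zero.1 h3 with h3 | h3
  · exact h3
  · have : z.im ^ 2 ≤ 0 := by nlinarith
    exact pow_eq_zero_iff two_ne_zero |>.1 (le_antisymm this (sq_nonneg _))

/-- With nonpositive discriminant the roots are conjugate or equal, and their product is the
determinant. Hence moduli cannot move as long as the determinant is fixed. -/
theorem norm_eq_of_mem_complexEigenvalues {M : Matrix (Fin 2) (Fin 2) ℝ}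
    (h : M.trace ^ 2 ≤ 4 * M.det) {z : ℂ} (hz : z ∈ complexEigenvalues M) :
    ‖z‖ = √M.det := by
  rw [mem_complexEigenvalues_fin_two] at hz
  have h1 := congrArg Complex.re hz
  have h2 := congrArg Complex.im hz
  simp [sq] at h1 h2
  have h3 : z.im * (2 * z.re - M.trace) = 0 := by linarith
  rw [Complex.norm_def, Complex.normSq_apply]
  congr 1
  rcases mul_eq_zero.1 h3 with h3 | h3
  · rw [h3] at h1 ⊢
    have : (2 * z.re - M.trace) ^ 2 ≤ 0 := by nlinarith
    have := pow_eq_zero_iff two_ne_zero |>.1 (le_antisymm this (sq_nonneg _))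
    nlinarith
  · have h4 : z.re = M.trace / 2 := by linarith
    rw [h4] at h1 ⊢
    nlinarith

theorem map_norm_complexEigenvalues_fin_two {M : Matrix (Fin 2) (Fin 2) ℝ}
    (h : M.trace ^ 2 ≤ 4 * M.det) :
    (complexEigenvalues M).map (fun z => ‖z‖) = Multiset.replicate 2 √M.det := by
  rw [Multiset.eq_replicate]
  refine ⟨by simp [card_complexEigenvalues], ?_⟩
  intro b hb
  obtain ⟨z, hz, rfl⟩ := Multiset.mem_map.1 hb
  exact norm_eq_of_mem_complexEigenvalues h hz

/-- This is `tr (A W) ≥ 2 √(det A)` for positive definite `A = (p q; q r)` and `W` with `det W = 1`: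
the arithmetic-geometric inequality on the diagonal terms, then Cauchy-Schwarz on `(s² + q²)(1 +
w₂²)`. -/
theorem two_mul_sqrt_le_of_posDef {p q r w₁ w₂ w₃ : ℝ} (hp : 0 < p) (hpr : 0 < p * r - q ^ 2)
    (hw : 0 < w₁) (hdet : w₁ * w₃ - w₂ ^ 2 = 1) :
    2 * √(p * r - q ^ 2) ≤ p * w₁ + 2 * q * w₂ + r * w₃ := by
  set s := √(p * r - q ^ 2) with hs
  have hs2 : s ^ 2 = p * r - q ^ 2 := Real.sq_sqrt hpr.le
  have hs0 : 0 ≤ s := Real.sqrt_nonneg _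
  have hr : 0 < r := by
    by_contra hr
    nlinarith [mul_nonneg hp.le (neg_nonneg.2 (not_lt.1 hr)), sq_nonneg q]
  have hw3 : 0 < w₃ := by
    by_contra hr
    nlinarith [mul_nonneg hw.le (neg_nonneg.2 (not_lt.1 hr)), sq_nonneg w₂]
  have hm0 : 0 ≤ |q * w₂| := abs_nonneg _
  have hm2 : |q * w₂| = |q| * |w₂| := abs_mul _ _
  have h1 : (2 * (s + |q * w₂|)) ^ 2 ≤ (p * w₁ + r * w₃) ^ 2 := by
    have e1 : p * r = s ^ 2 + q ^ 2 := by linarith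
    have e2 : w₁ * w₃ = 1 + w₂ ^ 2 := by linarith
    have e3 : (p * w₁ + r * w₃) ^ 2 =
        (p * w₁ - r * w₃) ^ 2 + 4 * ((s ^ 2 + q ^ 2) * (1 + w₂ ^ 2)) := by
      rw [← e1, ← e2]; ring
    rw [e3, hm2]
    nlinarith [sq_nonneg (p * w₁ - r * w₃), sq_nonneg (s * |w₂| - |q|), sq_abs q, sq_abs w₂]
  have h2 := abs_le_of_sq_le_sq' h1 (by positivity) |>.2
  linarith [neg_abs_le (q * w₂)]

/-- Only the symmetric part of `M * quarterTurn` matters against a symmetric `W`. Its determinant is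
minus a quarter of the discriminant of `M`, so it is definite, and `σ` makes it positive. -/
theorem sqrt_le_trace_mul {M W : Matrix (Fin 2) (Fin 2) ℝ} {σ : ℝ} (hσ : σ ^ 2 = 1)
    (hM : M.trace ^ 2 < 4 * M.det) (hb : 0 < σ * M 0 1) (hW : W 0 1 = W 1 0) (hW0 : 0 < W 0 0)
    (hdet : W.det = 1) :
    √(4 * M.det - M.trace ^ 2) ≤ σ * (M * quarterTurn * W).trace := by
  rw [Matrix.det_fin_two] at hdet hM
  rw [Matrix.trace_fin_two] at hM
  have key := two_mul_sqrt_le_of_posDef (p := σ * M 0 1) (q := σ * ((M 1 1 - M 0 0) / 2))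
    (r := σ * (-M 1 0)) (w₁ := W 0 0) (w₂ := W 0 1) (w₃ := W 1 1) hb
    (by linear_combination (1 / 4) * hM + (M 0 1 * M 1 0 + ((M 1 1 - M 0 0) / 2) ^ 2) * hσ)
    hW0 (by rw [← hdet, ← hW]; ring)
  have e : 4 * M.det - M.trace ^ 2 = 2 ^ 2 * (σ * M 0 1 * (σ * (-M 1 0)) -
      (σ * ((M 1 1 - M 0 0) / 2)) ^ 2) := by
    rw [Matrix.det_fin_two, Matrix.trace_fin_two]
    linear_combination (4 * M 0 1 * M 1 0 + (M 1 1 - M 0 0) ^ 2) * hσ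
  rw [e, Real.sqrt_mul (by norm_num), Real.sqrt_sq (by norm_num)]
  refine key.trans (le_of_eq ?_)
  simp [Matrix.trace_fin_two, Matrix.mul_apply, Fin.sum_univ_two, quarterTurn, ← hW]
  ring

theorem mul_quarterTurn_mul_transpose (P : Matrix (Fin 2) (Fin 2) ℝ) :
    P * quarterTurn * P.transpose = P.det • quarterTurn := by
  ext i j
  fin_cases i <;> fin_cases j <;>
    simp [quarterTurn, Matrix.mul_apply, Fin.sum_univ_two, Matrix.det_fin_two] <;> ring

/-- The product of the matrices `S i` twisted by rotations of angle `±α`, whose signs take into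
account the orientation of the partial products. -/
noncomputable def twistedProd (S : ℕ → Matrix (Fin 2) (Fin 2) ℝ) (k : ℕ) (α : ℝ) :
    Matrix (Fin 2) (Fin 2) ℝ :=
  matProd (fun i => S i * planeRotation ((matProd S i).det / |(matProd S i).det| * α)) k

theorem det_twistedProd (S : ℕ → Matrix (Fin 2) (Fin 2) ℝ) (k : ℕ) (α : ℝ) :
    (twistedProd S k α).det = (matProd S k).det := by
  simp [twistedProd, matProd_det, det_planeRotation]

theorem twistedProd_zero (S : ℕ → Matrix (Fin 2) (Fin 2) ℝ) (k : ℕ) :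
    twistedProd S k 0 = matProd S k := by
  simp [twistedProd, planeRotation_zero]

/-- Differentiating the `i`-th rotation inserts a signed quarter turn before the partial product
`P`. Since `P * quarterTurn * Pᵀ = det P • quarterTurn`, that turn can be moved to the right of `P`,
leaving `PᵀP / |det P|`. The sign in the angle cancels the sign of `det P`, so every term is the
full product times a quarter turn times a positive definite matrix of determinant 1. -/
theorem hasDerivAt_twistedProd {S : ℕ → Matrix (Fin 2) (Fin 2) ℝ} (hS : ∀ i, (S i).det ≠ 0)
    (k : ℕ) (α : ℝ) :
    HasDerivAt (twistedProd S k) (∑ i ∈ Finset.range k, twistedProd S k α * quarterTurn *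
      (|(matProd S i).det|⁻¹ • ((twistedProd S i α).transpose * twistedProd S i α))) α := by
  induction k with
  | zero =>
    have : twistedProd S 0 = fun _ => 1 := rfl
    rw [this]
    simpa using hasDerivAt_const α (1 : Matrix (Fin 2) (Fin 2) ℝ)
  | succ k ih =>
    have hd : (matProd S k).det ≠ 0 := by
      rw [matProd_det]; exact Finset.prod_ne_zero_iff.2 fun i _ => hS i
    set s := (matProd S k).det / |(matProd S k).det| with hs
    have hrec : twistedProd S (k + 1) = fun α => S k * planeRotation (s * α) * twistedProd S k α :=
      rfl
    have h1 : HasDerivAt (fun α => planeRotation (s * α))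
        (s • (planeRotation (s * α) * quarterTurn)) α :=
      ((hasDerivAt_planeRotation (s * α)).scomp α ((hasDerivAt_id α).const_mul s)).congr_deriv
        (by rw [mul_one])
    have h2 := (h1.const_mul (S k)).mul ih
    rw [hrec]
    refine h2.congr_deriv (Eq.symm ?_)
    rw [Finset.sum_range_succ, add_comm, Finset.mul_sum]
    congr 1
    · have e : twistedProd S k α * quarterTurn * (twistedProd S k α).transpose =
          (matProd S k).det • quarterTurn := by
        rw [mul_quarterTurn_mul_transpose, det_twistedProd]
      have e2 : |(matProd S k).det|⁻¹ * (matProd S k).det = s := by rw [hs]; field_simp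
      calc _ = |(matProd S k).det|⁻¹ • (S k * planeRotation (s * α) *
            (twistedProd S k α * quarterTurn * (twistedProd S k α).transpose) *
            twistedProd S k α) := by
            simp only [Matrix.mul_assoc, Matrix.mul_smul]
        _ = _ := by
          rw [e, Matrix.mul_smul, Matrix.smul_mul, smul_smul, e2]
          simp only [Matrix.mul_assoc, Matrix.mul_smul, Matrix.smul_mul]
    · refine Finset.sum_congr rfl fun i _ => ?_
      simp only [Matrix.mul_assoc]

theorem continuous_twistedProd {S : ℕ → Matrix (Fin 2) (Fin 2) ℝ} (hS : ∀ i, (S i).det ≠ 0)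
    (k : ℕ) : Continuous (twistedProd S k) :=
  continuous_iff_continuousAt.2 fun α => (hasDerivAt_twistedProd hS k α).continuousAt

theorem hasDerivAt_trace_twistedProd {S : ℕ → Matrix (Fin 2) (Fin 2) ℝ} (hS : ∀ i, (S i).det ≠ 0)
    (k : ℕ) (α : ℝ) :
    HasDerivAt (fun α => (twistedProd S k α).trace)
      (∑ i ∈ Finset.range k, (twistedProd S k α * quarterTurn *
      (|(matProd S i).det|⁻¹ • ((twistedProd S i α).transpose * twistedProd S i α))).trace) α := by
  have h := (LinearMap.toContinuousLinearMap
    (Matrix.traceLinearMap (Fin 2) ℝ ℝ)).hasFDerivAt.comp_hasDerivAt α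
      (hasDerivAt_twistedProd hS k α)
  refine h.congr_deriv ?_
  simp

/-- As long as the eigenvalues are not real, the rotation number moves with speed at least `ℓ`. -/
theorem le_deriv_trace_twistedProd {S : ℕ → Matrix (Fin 2) (Fin 2) ℝ} (hS : ∀ i, (S i).det ≠ 0)
    {k : ℕ} {α σ : ℝ} (hσ : σ ^ 2 = 1)
    (hM : (twistedProd S k α).trace ^ 2 < 4 * (matProd S k).det)
    (hb : 0 < σ * twistedProd S k α 0 1) :
    k * √(4 * (matProd S k).det - (twistedProd S k α).trace ^ 2) ≤
      σ * ∑ i ∈ Finset.range k, (twistedProd S k α * quarterTurn *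
      (|(matProd S i).det|⁻¹ • ((twistedProd S i α).transpose * twistedProd S i α))).trace := by
  rw [Finset.mul_sum]
  refine le_of_eq_of_le ?_ (Finset.sum_le_sum (f := fun _ =>
    √(4 * (matProd S k).det - (twistedProd S k α).trace ^ 2)) fun i _ => ?_)
  · simp
  have hd : (matProd S i).det ≠ 0 := by
      rw [matProd_det]; exact Finset.prod_ne_zero_iff.2 fun i _ => hS i
  rw [← det_twistedProd S k α] at hM ⊢
  rw [← det_twistedProd S i α] at hd ⊢
  set P := twistedProd S i α
  refine sqrt_le_trace_mul hσ hM hb ?_ ?_ ?_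
  · simp [Matrix.mul_apply, Fin.sum_univ_two]; left; ring
  · have : 0 < |P.det|⁻¹ := by positivity
    simp only [Matrix.smul_apply, smul_eq_mul]
    refine mul_pos this ?_
    simp only [Matrix.mul_apply, Fin.sum_univ_two, Matrix.transpose_apply]
    by_contra hle
    have h0 : P 0 0 = 0 := by nlinarith
    have h1 : P 1 0 = 0 := by nlinarith
    exact hd (by rw [Matrix.det_fin_two, h0, h1]; ring)
  · rw [Matrix.det_smul, Matrix.det_mul, Matrix.det_transpose]
    simp only [Fintype.card_fin, ← sq, inv_pow, sq_abs]
    field_simp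

/-- Otherwise the eigenvalue angle would be defined and monotone on all of `[0, ε]` and vary by at
least `ℓ ε ≥ π`, although it stays in an open interval of length `π`. -/
theorem exists_discr_nonneg {S : ℕ → Matrix (Fin 2) (Fin 2) ℝ} (hS : ∀ i, (S i).det ≠ 0)
    {ε : ℝ} (hε : 0 < ε) {ℓ : ℕ} (hℓ : Real.pi ≤ ℓ * ε) :
    ∃ α ∈ Set.Icc 0 ε, 4 * (matProd S ℓ).det ≤ (twistedProd S ℓ α).trace ^ 2 := by
  by_contra! hcon
  set Δ := (matProd S ℓ).det with hΔ
  have h0 : (0 : ℝ) ∈ Set.Icc 0 ε := ⟨le_rfl, hε.le⟩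
  have hΔ0 : 0 < Δ := by nlinarith [hcon 0 h0, sq_nonneg (twistedProd S ℓ 0).trace]
  -- A zero off-diagonal entry makes the matrix triangular, with real eigenvalues.
  have hne : ∀ α ∈ Set.Icc 0 ε, twistedProd S ℓ α 0 1 ≠ 0 := by
    intro α hα hb
    have h1 := hcon α hα
    rw [hΔ, ← det_twistedProd S ℓ α, Matrix.det_fin_two, Matrix.trace_fin_two, hb] at h1
    nlinarith [sq_nonneg (twistedProd S ℓ α 0 0 - twistedProd S ℓ α 1 1)]
  have hcont : Continuous fun α => twistedProd S ℓ α 0 1 :=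
    (continuous_twistedProd hS ℓ).matrix_elem 0 1
  obtain ⟨σ, hσ, hσb⟩ : ∃ σ : ℝ, σ ^ 2 = 1 ∧ ∀ α ∈ Set.Icc 0 ε, 0 < σ * twistedProd S ℓ α 0 1 := by
    rcases (hne 0 h0).lt_or_gt with h | h
    · refine ⟨-1, by norm_num, fun α hα => ?_⟩
      by_contra hc
      obtain ⟨x, hx, hx0⟩ := isPreconnected_Icc.intermediate_value h0 hα hcont.continuousOn
        (show (0 : ℝ) ∈ Set.Icc _ _ from ⟨h.le, by linarith⟩)
      exact hne x hx hx0
    · refine ⟨1, by norm_num, fun α hα => ?_⟩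
      by_contra hc
      obtain ⟨x, hx, hx0⟩ := isPreconnected_Icc.intermediate_value hα h0 hcont.continuousOn
        (show (0 : ℝ) ∈ Set.Icc _ _ from ⟨by linarith, h.le⟩)
      exact hne x hx hx0
  -- `f` is the cosine of the eigenvalue angle, so `arcsin (f α)` is that angle up to sign and a
  -- constant.
  set f : ℝ → ℝ := fun α => (twistedProd S ℓ α).trace / (2 * √Δ) with hf
  have hs : 0 < √Δ := Real.sqrt_pos.2 hΔ0
  have hs2 : √Δ ^ 2 = Δ := Real.sq_sqrt hΔ0.le
  have hf1 : ∀ α ∈ Set.Icc 0 ε, -1 < f α ∧ f α < 1 := by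
    intro α hα
    rw [← abs_lt, ← sq_lt_one_iff_abs_lt_one, hf]
    simp only [div_pow, mul_pow, hs2]
    rw [div_lt_one (by positivity)]
    linarith [hcon α hα]
  have hder : ∀ α ∈ Set.Icc 0 ε, ∃ g', HasDerivAt (fun α => σ * Real.arcsin (f α)) g' α ∧ ℓ ≤ g' := by
    intro α hα
    have h1 := (hasDerivAt_trace_twistedProd hS ℓ α).div_const (2 * √Δ)
    have h2 := ((Real.hasDerivAt_arcsin (hf1 α hα).1.ne' (hf1 α hα).2.ne).comp α h1).const_mul σ
    refine ⟨_, h2, ?_⟩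
    have h3 := le_deriv_trace_twistedProd hS hσ (hcon α hα) (hσb α hα)
    have hpos : 0 < 4 * Δ - (twistedProd S ℓ α).trace ^ 2 := by linarith [hcon α hα]
    have e : 1 - f α ^ 2 = (4 * Δ - (twistedProd S ℓ α).trace ^ 2) / (2 * √Δ) ^ 2 := by
      rw [hf]; field_simp; rw [hs2]; ring
    rw [e, Real.sqrt_div' _ (by positivity), Real.sqrt_sq (by positivity)]
    have hq := Real.sqrt_pos.2 hpos
    rw [← hΔ] at h3
    rw [← le_div_iff₀ hq] at h3
    refine h3.trans (le_of_eq ?_)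
    field_simp
  have hmv := (convex_Icc (0 : ℝ) ε).mul_sub_le_image_sub_of_le_deriv
    (f := fun α => σ * Real.arcsin (f α)) (C := ℓ)
    (fun α hα => (hder α hα).choose_spec.1.continuousAt.continuousWithinAt)
    (fun α hα => (hder α (interior_subset hα)).choose_spec.1.differentiableAt.differentiableWithinAt)
    (fun α hα => by
      obtain ⟨g', h1, h2⟩ := hder α (interior_subset hα)
      rw [h1.deriv]; exact h2) 0 h0 ε ⟨hε.le, le_rfl⟩ hε.le
  have hε1 : ε ∈ Set.Icc 0 ε := ⟨hε.le, le_rfl⟩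
  have a1 := (Real.arcsin_lt_pi_div_two).2 (hf1 0 h0).2
  have a2 := (Real.neg_pi_div_two_lt_arcsin).2 (hf1 0 h0).1
  have a3 := (Real.arcsin_lt_pi_div_two).2 (hf1 ε hε1).2
  have a4 := (Real.neg_pi_div_two_lt_arcsin).2 (hf1 ε hε1).1
  rcases (mul_self_eq_one_iff.1 ((sq σ).symm.trans hσ)) with rfl | rfl <;> linarith

theorem exists_isRotationPath_fin_two {S : ℕ → Matrix (Fin 2) (Fin 2) ℝ}
    (hS : ∀ i, (S i).det ≠ 0) {ε : ℝ} (hε : 0 < ε) {ℓ : ℕ} (hℓ : Real.pi ≤ ℓ * ε) :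
    ∃ D, IsRotationPath ε ℓ S D := by
  set Z : Set ℝ := {α ∈ Set.Icc 0 ε | 4 * (matProd S ℓ).det ≤ (twistedProd S ℓ α).trace ^ 2}
  have hcont : Continuous fun α => (twistedProd S ℓ α).trace ^ 2 :=
    ((continuous_twistedProd hS ℓ).matrix_trace).pow 2
  have hZ : IsCompact Z := isCompact_Icc.inter_right (isClosed_le continuous_const hcont)
  -- Stopping at the first parameter with real eigenvalues matters: beyond it the two moduli could
  -- separate.
  obtain ⟨a, ⟨ha, haZ⟩, hmin⟩ := hZ.exists_isLeast (exists_discr_nonneg hS hε hℓ)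
  rcases ha.1.eq_or_lt with h0 | h0
  · refine ⟨_, isRotationPath_one hε.le fun z hz => ?_⟩
    rw [← h0, twistedProd_zero] at haZ
    exact im_eq_zero_of_mem_complexEigenvalues haZ hz
  have hlt : ∀ x ∈ Set.Ico 0 a, (twistedProd S ℓ x).trace ^ 2 ≤ 4 * (matProd S ℓ).det := by
    intro x hx
    by_contra hc
    exact hx.2.not_ge (hmin ⟨⟨hx.1, hx.2.le.trans ha.2⟩, (not_le.1 hc).le⟩)
  have hle : ∀ x ∈ Set.Icc 0 a, (twistedProd S ℓ x).trace ^ 2 ≤ 4 * (matProd S ℓ).det := by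
    have hcl : IsClosed {x | (twistedProd S ℓ x).trace ^ 2 ≤ 4 * (matProd S ℓ).det} :=
      isClosed_le hcont continuous_const
    rw [← closure_Ico h0.ne]
    exact closure_minimal hlt hcl
  have hprod : ∀ t : ℝ, matProd (fun i => S i *
      planeRotation ((matProd S i).det / |(matProd S i).det| * (t * a))) ℓ =
      twistedProd S ℓ (t * a) := fun _ => rfl
  refine ⟨fun t i => planeRotation ((matProd S i).det / |(matProd S i).det| * (t * a)),
    fun i => ?_, fun i => ?_, fun t i => planeRotation_transpose_mul_self _,
    fun t i => det_planeRotation _, fun t i => ?_, fun t => ?_, fun z hz => ?_⟩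
  · exact continuous_planeRotation.comp (by fun_prop)
  · simp [planeRotation_zero]
  · refine (norm_planeRotation_sub_one_le _).trans ?_
    have hd : (matProd S i).det ≠ 0 := by
      rw [matProd_det]; exact Finset.prod_ne_zero_iff.2 fun i _ => hS i
    rw [abs_mul, abs_div, abs_abs, div_self (abs_ne_zero.2 hd), one_mul, abs_mul,
      abs_of_nonneg t.2.1, abs_of_pos h0]
    nlinarith [t.2.1, t.2.2, ha.2]
  · rw [hprod, ← twistedProd_zero S ℓ, map_norm_complexEigenvalues_fin_two,
      map_norm_complexEigenvalues_fin_two, det_twistedProd, det_twistedProd]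
    · rw [det_twistedProd]; exact hle 0 ⟨le_rfl, h0.le⟩
    · rw [det_twistedProd]
      exact hle _ ⟨mul_nonneg t.2.1 h0.le, mul_le_of_le_one_left h0.le t.2.2⟩
  · rw [hprod] at hz
    refine im_eq_zero_of_mem_complexEigenvalues ?_ hz
    rw [det_twistedProd]
    simpa using haZ

end Planar

/-! ### Invariant subspaces of small dimension -/

section InvariantSubspaces

open Polynomial

variable {E : Type*} [AddCommGroup E] [Module ℝ E]

/-- Strip irreducible factors from `q` one at a time. The first factor whose removal takes the image
of `u` out of `W` is `p`, and that image is `v`. -/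
theorem exists_irreducible_aeval_mem {f : E →ₗ[ℝ] E} {U W : Submodule ℝ E}
    (hU : ∀ x ∈ U, f x ∈ U) {u : E} (hu : u ∈ U) (huW : u ∉ W) {q : ℝ[X]} (hq : q ≠ 0)
    (hquW : aeval f q u ∈ W) :
    ∃ p : ℝ[X], Irreducible p ∧ p ∣ q ∧ ∃ v ∈ U, v ∉ W ∧ aeval f p v ∈ W := by
  induction q using WfDvdMonoid.induction_on_irreducible with
  | zero => exact absurd rfl hq
  | unit q hqu =>
    obtain ⟨c, hc, rfl⟩ := Polynomial.isUnit_iff.1 hqu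
    rw [aeval_C, Module.algebraMap_end_apply] at hquW
    exact absurd ((W.smul_mem_iff hc.ne_zero).1 hquW) huW
  | mul q p hq0 hp ih =>
    by_cases h : aeval f q u ∈ W
    · obtain ⟨p', h1, h2, h3⟩ := ih hq0 h
      exact ⟨p', h1, h2.mul_left _, h3⟩
    · refine ⟨p, hp, dvd_mul_right _ _, aeval f q u, ?_, h, ?_⟩
      · have hmem : ∀ r : ℝ[X], aeval f r u ∈ U := by
          intro r
          induction r using Polynomial.induction_on' with
          | add r s hr hs => rw [map_add]; exact U.add_mem hr hs
          | monomial k c =>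
            rw [aeval_monomial, Module.End.mul_apply, Module.algebraMap_end_apply]
            refine U.smul_mem c ?_
            induction k with
            | zero => simpa using hu
            | succ k ih => rw [pow_succ']; exact hU _ ih
        exact hmem q
      · rwa [map_mul] at hquW

/-- A vector of `U` outside `W` which generates over `W` an invariant subspace of relative
dimension one or two. -/
theorem exists_low_degree_relation {f : E →ₗ[ℝ] E} {U W : Submodule ℝ E}
    (hU : ∀ x ∈ U, f x ∈ U) {u : E} (hu : u ∈ U) (huW : u ∉ W) {q : ℝ[X]} (hq : q ≠ 0)
    (hquW : aeval f q u ∈ W) :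
    ∃ v ∈ U, v ∉ W ∧ ((∃ c : ℝ, f v - c • v ∈ W) ∨ ∃ a b : ℝ, f (f v) + a • f v + b • v ∈ W ∧
      Irreducible (X ^ 2 + C a * X + C b) ∧ X ^ 2 + C a * X + C b ∣ q) := by
  obtain ⟨p, hp, hpq, v, hvU, hvW, hpv⟩ := exists_irreducible_aeval_mem hU hu huW hq hquW
  refine ⟨v, hvU, hvW, ?_⟩
  have hp0 := hp.natDegree_pos
  have hp2 := hp.natDegree_le_two
  have hlead : p.leadingCoeff ≠ 0 := leadingCoeff_ne_zero.2 hp.ne_zero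
  have h12 : p.natDegree = 1 ∨ p.natDegree = 2 := by omega
  rcases h12 with h | h
  · left
    have e : p = C (p.coeff 1) * X + C (p.coeff 0) := eq_X_add_C_of_natDegree_le_one h.le
    rw [leadingCoeff, h] at hlead
    rw [e] at hpv
    simp only [map_add, map_mul, aeval_C, aeval_X, LinearMap.add_apply, Module.End.mul_apply,
      Module.algebraMap_end_apply] at hpv
    refine ⟨-(p.coeff 1)⁻¹ * p.coeff 0, ?_⟩
    have := W.smul_mem (p.coeff 1)⁻¹ hpv
    rw [smul_add, smul_smul, smul_smul, inv_mul_cancel₀ hlead, one_smul] at this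
    simpa [sub_eq_add_neg] using this
  · right
    rw [leadingCoeff, h] at hlead
    have e : p = C (p.coeff 2) * (X ^ 2 + C ((p.coeff 2)⁻¹ * p.coeff 1) * X +
        C ((p.coeff 2)⁻¹ * p.coeff 0)) := by
      conv_lhs => rw [p.as_sum_range_C_mul_X_pow, h]
      simp only [Finset.sum_range_succ, Finset.range_zero, Finset.sum_empty, map_mul]
      have hc : C (p.coeff 2) * C (p.coeff 2)⁻¹ = (1 : ℝ[X]) := by
        rw [← C_mul, mul_inv_cancel₀ hlead, C_1]
      linear_combination (-(C (p.coeff 1) * X + C (p.coeff 0))) * hc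
    set r := X ^ 2 + C ((p.coeff 2)⁻¹ * p.coeff 1) * X + C ((p.coeff 2)⁻¹ * p.coeff 0) with hr
    refine ⟨(p.coeff 2)⁻¹ * p.coeff 1, (p.coeff 2)⁻¹ * p.coeff 0, ?_,
      (irreducible_isUnit_mul (isUnit_C.2 hlead.isUnit)).1 (e ▸ hp),
      (Dvd.intro_left _ e.symm).trans hpq⟩
    rw [e, map_mul, aeval_C, Module.End.mul_apply, Module.algebraMap_end_apply] at hpv
    have := (W.smul_mem_iff hlead).1 hpv
    rw [mul_comm _ (p.coeff 1), mul_comm _ (p.coeff 0), mul_smul, mul_smul]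
    simpa [hr, pow_two] using this

/-- Cayley-Hamilton supplies an annihilating polynomial, so some `v ≠ 0` satisfies a relation of
degree 1 or 2, and the span of `v` and `f v` is invariant. -/
theorem exists_invariant_submodule [FiniteDimensional ℝ E] (f : E →ₗ[ℝ] E)
    (hE : 3 ≤ Module.finrank ℝ E) :
    ∃ V : Submodule ℝ E, (∀ x ∈ V, f x ∈ V) ∧ 0 < Module.finrank ℝ V ∧
      Module.finrank ℝ V < Module.finrank ℝ E := by
  have : Nontrivial E := Module.nontrivial_of_finrank_pos (R := ℝ) (by omega)
  obtain ⟨u, hu⟩ := exists_ne (0 : E)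
  obtain ⟨v, -, hv, hrel⟩ := exists_low_degree_relation (f := f) (U := ⊤) (W := ⊥)
    (fun _ _ => Submodule.mem_top) (Submodule.mem_top (x := u)) (by simpa using hu)
    (LinearMap.charpoly_monic f).ne_zero (by rw [LinearMap.aeval_self_charpoly]; simp)
  have hv0 : v ≠ 0 := by simpa using hv
  set V := Submodule.span ℝ {v, f v} with hV
  have h1 : v ∈ V := Submodule.subset_span (by simp)
  have h2 : f v ∈ V := Submodule.subset_span (by simp)
  have h3 : f (f v) ∈ V := by
    rcases hrel with ⟨c, hc⟩ | ⟨a, b, hab, -⟩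
    · have : f v = c • v := sub_eq_zero.1 (by simpa using hc)
      rw [this, map_smul]
      exact V.smul_mem c h2
    · have : f (f v) = -(a • f v + b • v) := by
        rw [Submodule.mem_bot, add_assoc] at hab
        exact eq_neg_of_add_eq_zero_left hab
      rw [this]
      exact V.neg_mem (V.add_mem (V.smul_mem a h2) (V.smul_mem b h1))
  refine ⟨V, fun x hx => ?_, ?_, ?_⟩
  · have : V ≤ V.comap f := by
      rw [hV, Submodule.span_le, ← hV]
      rintro y (rfl | rfl)
      · exact h2
      · exact h3
    exact this hx
  · have : Nontrivial V := ⟨⟨⟨v, h1⟩, 0, fun h => hv0 (congrArg Subtype.val h)⟩⟩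
    exact Module.finrank_pos
  · have : Module.finrank ℝ V ≤ 2 := by
      classical
      have := finrank_span_finset_le_card (R := ℝ) ({v, f v} : Finset E)
      rw [Finset.coe_pair] at this
      exact this.trans Finset.card_le_two
    omega

end InvariantSubspaces

/-! ### Orthogonal frames and block matrices -/

section Frames

variable {n m k : Type*} [Fintype n] [DecidableEq n] [Fintype m] [DecidableEq m] [Fintype k]
  [DecidableEq k]

/-- An orthogonal matrix whose first columns lie in `V` and whose last columns are orthogonal
to `V`. -/
structure IsFrame (V : Submodule ℝ (n → ℝ)) (Q : Matrix n (m ⊕ k) ℝ) : Prop where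
  transpose_mul : Q.transpose * Q = 1
  mul_transpose : Q * Q.transpose = 1
  mem : ∀ j, (fun i => Q i (Sum.inl j)) ∈ V
  orthogonal : ∀ j, ∀ v ∈ V, v ⬝ᵥ (fun i => Q i (Sum.inr j)) = 0

omit [DecidableEq n] in
theorem exists_orthonormal_columns (V : Submodule ℝ (n → ℝ)) {r : ℕ}
    (hV : Module.finrank ℝ V = r) :
    ∃ b : Fin r → n → ℝ, (∀ j, b j ∈ V) ∧ ∀ i j, b i ⬝ᵥ b j = if i = j then 1 else 0 := by
  set e := (WithLp.linearEquiv 2 ℝ (n → ℝ)).symm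
  set V' : Submodule ℝ (EuclideanSpace ℝ n) := V.map (e : (n → ℝ) →ₗ[ℝ] EuclideanSpace ℝ n)
  have hV' : Module.finrank ℝ V' = r := by rw [← hV]; exact LinearEquiv.finrank_map_eq e V
  let b := (stdOrthonormalBasis ℝ V').reindex (finCongr hV')
  refine ⟨fun j => e.symm (b j : EuclideanSpace ℝ n), fun j => ?_, fun i j => ?_⟩
  · obtain ⟨x, hx, hx'⟩ := (b j).2
    show e.symm (b j : EuclideanSpace ℝ n) ∈ V
    rw [← hx']
    simpa using hx
  · have h := orthonormal_iff_ite.1 b.orthonormal i j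
    rw [← h, Submodule.coe_inner, EuclideanSpace.inner_eq_star_dotProduct, dotProduct_comm]
    rfl

theorem exists_isFrame (V : Submodule ℝ (n → ℝ)) {r s : ℕ} (hV : Module.finrank ℝ V = r)
    (hrs : Fintype.card n = r + s) : ∃ Q : Matrix n (Fin r ⊕ Fin s) ℝ, IsFrame V Q := by
  obtain ⟨b, hbV, hb⟩ := exists_orthonormal_columns V hV
  set B : LinearMap.BilinForm ℝ (n → ℝ) := Matrix.toBilin' 1 with hB
  have hBd : ∀ x y, B x y = x ⬝ᵥ y := fun x y => by simp [hB, Matrix.toBilin'_apply']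
  have hnd : B.Nondegenerate := by
    rw [hB]
    exact Matrix.nondegenerate_toBilin'_iff.2 (Matrix.Nondegenerate.of_det_ne_zero (by simp))
  have hW : Module.finrank ℝ (B.orthogonal V) = s := by
    rw [LinearMap.BilinForm.finrank_orthogonal hnd, hV, Module.finrank_fintype_fun_eq_card]
    omega
  obtain ⟨c, hcW, hc⟩ := exists_orthonormal_columns _ hW
  have hcV : ∀ j, ∀ v ∈ V, v ⬝ᵥ c j = 0 := fun j v hv => by
    rw [← hBd]; exact hcW j v hv
  have h1 : (Matrix.of fun i => Sum.elim (fun j => b j i) fun j => c j i :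
      Matrix n (Fin r ⊕ Fin s) ℝ).transpose * (Matrix.of fun i => Sum.elim (fun j => b j i)
        fun j => c j i) = 1 := by
    ext i j
    rw [Matrix.mul_apply]
    rcases i with i | i <;> rcases j with j | j
    · simpa [dotProduct, Matrix.one_apply] using hb i j
    · simpa [dotProduct] using hcV j _ (hbV i)
    · simpa [dotProduct] using (dotProduct_comm _ _).trans (hcV i _ (hbV j))
    · simpa [dotProduct, Matrix.one_apply] using hc i j
  exact ⟨_, h1, (Matrix.mul_eq_one_comm_of_card_eq _ _ _ (by simp [hrs])).1 h1, hbV, hcV⟩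

/-- The lower-left block pairs vectors of `S V ⊆ V'` with columns orthogonal to `V'`. -/
theorem IsFrame.exists_fromBlocks {V V' : Submodule ℝ (n → ℝ)} {Q Q' : Matrix n (m ⊕ k) ℝ}
    (hQ : IsFrame V Q) (hQ' : IsFrame V' Q') {S : Matrix n n ℝ} (hS : ∀ v ∈ V, S.mulVec v ∈ V') :
    ∃ A B D, Q'.transpose * S * Q = Matrix.fromBlocks A B 0 D := by
  set T := Q'.transpose * S * Q with hT
  refine ⟨T.toBlocks₁₁, T.toBlocks₁₂, T.toBlocks₂₂, (Matrix.fromBlocks_toBlocks T).symm.trans ?_⟩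
  congr 1
  ext i j
  have h := hQ'.orthogonal i _ (hS _ (hQ.mem j))
  rw [dotProduct_comm] at h
  rw [hT, Matrix.mul_assoc]
  exact h

omit [DecidableEq n] in
theorem norm_le_one_of_transpose_mul_self {Q : Matrix n m ℝ} (h : Q.transpose * Q = 1) :
    ‖Q‖ ≤ 1 := by
  have h1 := Matrix.l2_opNorm_conjTranspose_mul_self Q
  rw [Matrix.conjTranspose_eq_transpose_of_trivial, h] at h1
  have h2 : ‖(1 : Matrix m m ℝ)‖ ≤ 1 := by
    rw [← Matrix.diagonal_one, Matrix.l2_opNorm_diagonal]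
    exact (pi_norm_le_iff_of_nonneg zero_le_one).2 fun _ => by simp
  nlinarith [norm_nonneg Q]

theorem norm_conj_sub_one_le {Q : Matrix n m ℝ} (h : Q.transpose * Q = 1)
    (h' : Q * Q.transpose = 1) (X : Matrix m m ℝ) :
    ‖Q * X * Q.transpose - 1‖ ≤ ‖X - 1‖ := by
  have e : Q * X * Q.transpose - 1 = Q * (X - 1) * Q.transpose := by
    rw [Matrix.mul_sub, Matrix.sub_mul, Matrix.mul_one, h']
  have h1 := norm_le_one_of_transpose_mul_self h
  have h2 : ‖Q.transpose‖ ≤ 1 := norm_le_one_of_transpose_mul_self (by simpa using h')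
  rw [e]
  calc _ ≤ ‖Q * (X - 1)‖ * ‖Q.transpose‖ := Matrix.l2_opNorm_mul _ _
    _ ≤ (‖Q‖ * ‖X - 1‖) * ‖Q.transpose‖ := by gcongr; exact Matrix.l2_opNorm_mul _ _
    _ ≤ (1 * ‖X - 1‖) * 1 := by gcongr
    _ = _ := by ring

omit [DecidableEq n] in
theorem norm_toLp_sq (y : n → ℝ) :
    ‖(WithLp.toLp 2 y : EuclideanSpace ℝ n)‖ ^ 2 = ∑ j, y j ^ 2 := by
  simp [EuclideanSpace.norm_sq_eq]

theorem norm_fromBlocks_diagonal_le {A : Matrix m m ℝ} {D : Matrix k k ℝ} {c : ℝ}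
    (hA : ‖A‖ ≤ c) (hD : ‖D‖ ≤ c) : ‖Matrix.fromBlocks A 0 0 D‖ ≤ c := by
  have hc : 0 ≤ c := (norm_nonneg A).trans hA
  rw [Matrix.l2_opNorm_def]
  refine ContinuousLinearMap.opNorm_le_bound _ hc fun x => ?_
  set y : m → ℝ := fun j => x (Sum.inl j) with hy
  set z : k → ℝ := fun j => x (Sum.inr j) with hz
  have hx : x = WithLp.toLp 2 (Sum.elim y z) := by
    ext j; rcases j with j | j <;> rfl
  have h1 := (Matrix.l2_opNorm_mulVec A (WithLp.toLp 2 y)).trans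
    (mul_le_mul_of_nonneg_right hA (norm_nonneg _))
  have h2 := (Matrix.l2_opNorm_mulVec D (WithLp.toLp 2 z)).trans
    (mul_le_mul_of_nonneg_right hD (norm_nonneg _))
  have h1' := pow_le_pow_left₀ (norm_nonneg _) h1 2
  have h2' := pow_le_pow_left₀ (norm_nonneg _) h2 2
  rw [mul_pow] at h1' h2'
  have key : ‖(WithLp.toLp 2 ((Matrix.fromBlocks A 0 0 D).mulVec (Sum.elim y z)) :
      EuclideanSpace ℝ (m ⊕ k))‖ ≤ c * ‖x‖ := by
    refine (abs_le_of_sq_le_sq' ?_ (by positivity)).2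
    rw [mul_pow, hx, norm_toLp_sq, norm_toLp_sq, Fintype.sum_sum_type, Fintype.sum_sum_type,
      mul_add]
    rw [norm_toLp_sq y] at h1'
    rw [norm_toLp_sq z] at h2'
    refine add_le_add (le_of_eq_of_le ?_ h1') (le_of_eq_of_le ?_ h2')
    · erw [norm_toLp_sq]
      simp [Matrix.fromBlocks_mulVec]
    · erw [norm_toLp_sq]
      simp [Matrix.fromBlocks_mulVec]
  rw [hx] at key ⊢
  exact key

/-- Conjugation by `Q` of a block-diagonal matrix. -/
def blockConj (Q : Matrix n (m ⊕ k) ℝ) (F : Matrix m m ℝ) (G : Matrix k k ℝ) : Matrix n n ℝ :=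
  Q * Matrix.fromBlocks F 0 0 G * Q.transpose

omit [Fintype n] in
theorem blockConj_one {Q : Matrix n (m ⊕ k) ℝ} (h' : Q * Q.transpose = 1) :
    blockConj Q 1 1 = 1 := by
  rw [blockConj, Matrix.fromBlocks_one, Matrix.mul_one, h']

theorem blockConj_transpose_mul_self {Q : Matrix n (m ⊕ k) ℝ} (h : Q.transpose * Q = 1)
    (h' : Q * Q.transpose = 1) {F : Matrix m m ℝ} {G : Matrix k k ℝ} (hF : F.transpose * F = 1)
    (hG : G.transpose * G = 1) : (blockConj Q F G).transpose * blockConj Q F G = 1 := by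
  have e : (Matrix.fromBlocks F 0 0 G).transpose * Matrix.fromBlocks F 0 0 G = 1 := by
    rw [Matrix.fromBlocks_transpose, Matrix.fromBlocks_multiply]
    simp [hF, hG]
  calc _ = Q * ((Matrix.fromBlocks F 0 0 G).transpose * (Q.transpose * Q) *
        Matrix.fromBlocks F 0 0 G) * Q.transpose := by
        simp only [blockConj, Matrix.transpose_mul, Matrix.transpose_transpose, Matrix.mul_assoc]
    _ = 1 := by rw [h, Matrix.mul_one, e, Matrix.mul_one, h']

theorem det_blockConj {Q : Matrix n (m ⊕ k) ℝ} (h : Q.transpose * Q = 1)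
    (h' : Q * Q.transpose = 1) (F : Matrix m m ℝ) (G : Matrix k k ℝ) :
    (blockConj Q F G).det = F.det * G.det := by
  rw [blockConj, Matrix.det_conj_of_mul_eq_one h' h, Matrix.det_fromBlocks_zero₂₁]

theorem norm_blockConj_sub_one_le {Q : Matrix n (m ⊕ k) ℝ} (h : Q.transpose * Q = 1)
    (h' : Q * Q.transpose = 1) {F : Matrix m m ℝ} {G : Matrix k k ℝ} {c : ℝ} (hF : ‖F - 1‖ ≤ c)
    (hG : ‖G - 1‖ ≤ c) : ‖blockConj Q F G - 1‖ ≤ c := by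
  refine (norm_conj_sub_one_le h h' _).trans ?_
  have e : Matrix.fromBlocks F 0 0 G - 1 = Matrix.fromBlocks (F - 1) 0 0 (G - 1) := by
    rw [sub_eq_add_neg, ← Matrix.fromBlocks_one, Matrix.fromBlocks_neg, Matrix.fromBlocks_add]
    simp [sub_eq_add_neg]
  rw [e]
  exact norm_fromBlocks_diagonal_le hF hG

omit [Fintype n] [DecidableEq n] [DecidableEq m] [DecidableEq k] in
theorem continuous_blockConj {X : Type*} [TopologicalSpace X] (Q : Matrix n (m ⊕ k) ℝ)
    {F : X → Matrix m m ℝ} {G : X → Matrix k k ℝ} (hF : Continuous F) (hG : Continuous G) :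
    Continuous fun x => blockConj Q (F x) (G x) :=
  (continuous_const.matrix_mul
    (hF.matrix_fromBlocks continuous_const continuous_const hG)).matrix_mul continuous_const

/-- The eigenvalues of a product of block-triangular matrices in moving frames. -/
theorem complexEigenvalues_matProd_blockConj {S : ℕ → Matrix n n ℝ} {Q : ℕ → Matrix n (m ⊕ k) ℝ}
    (h : ∀ i, (Q i).transpose * Q i = 1) (h' : ∀ i, Q i * (Q i).transpose = 1) {ℓ : ℕ}
    (hℓ : Q ℓ = Q 0) {A : ℕ → Matrix m m ℝ} {B : ℕ → Matrix m k ℝ} {D : ℕ → Matrix k k ℝ}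
    (hS : ∀ i, (Q (i + 1)).transpose * S i * Q i = Matrix.fromBlocks (A i) (B i) 0 (D i))
    (F : ℕ → Matrix m m ℝ) (G : ℕ → Matrix k k ℝ) :
    complexEigenvalues (matProd (fun i => S i * blockConj (Q i) (F i) (G i)) ℓ) =
      complexEigenvalues (matProd (fun i => A i * F i) ℓ) +
      complexEigenvalues (matProd (fun i => D i * G i) ℓ) := by
  have e : ∀ i < ℓ, S i * blockConj (Q i) (F i) (G i) = Q (i + 1) *
      Matrix.fromBlocks (A i * F i) (B i * G i) 0 (D i * G i) * (Q i).transpose := by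
    intro i _
    have h1 : Matrix.fromBlocks (A i * F i) (B i * G i) 0 (D i * G i) =
        (Q (i + 1)).transpose * S i * Q i * Matrix.fromBlocks (F i) 0 0 (G i) := by
      rw [hS, Matrix.fromBlocks_multiply]; simp
    rw [h1, blockConj]
    calc _ = 1 * S i * (Q i * Matrix.fromBlocks (F i) 0 0 (G i) * (Q i).transpose) := by
          rw [Matrix.one_mul]
      _ = _ := by rw [← h' (i + 1)]; simp only [Matrix.mul_assoc]
  rw [matProd_frames h' e h, hℓ, complexEigenvalues_conj _ (h 0) (h' 0)]
  obtain ⟨B', hB'⟩ := matProd_fromBlocks (fun i => A i * F i) (fun i => B i * G i)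
    (fun i => D i * G i) ℓ
  rw [hB', complexEigenvalues_fromBlocks]

end Frames

/-! ### Frames moving along the sequence -/

section MovingFrames

variable {n m k : Type*} [Fintype n] [DecidableEq n] [Fintype m] [DecidableEq m] [Fintype k]
  [DecidableEq k]

/-- The image of a subspace under the product of the first `i` matrices. -/
def transport (S : ℕ → Matrix n n ℝ) (V : Submodule ℝ (n → ℝ)) (i : ℕ) : Submodule ℝ (n → ℝ) :=
  V.map (matProd S i).mulVecLin

theorem det_matProd_ne_zero {S : ℕ → Matrix n n ℝ} (hS : ∀ i, (S i).det ≠ 0) (k : ℕ) :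
    (matProd S k).det ≠ 0 := by
  rw [matProd_det]
  exact Finset.prod_ne_zero_iff.2 fun i _ => hS i

theorem finrank_map_mulVecLin {M : Matrix n n ℝ} (hM : M.det ≠ 0) (V : Submodule ℝ (n → ℝ)) :
    Module.finrank ℝ (V.map M.mulVecLin) = Module.finrank ℝ V := by
  have hinj : Function.Injective M.mulVecLin :=
    Matrix.mulVec_injective_iff_isUnit.2 ((Matrix.isUnit_iff_isUnit_det M).2 hM.isUnit)
  exact (Submodule.equivMapOfInjective _ hinj V).finrank_eq.symm

/-- Frames may be chosen independently at each time, as triangularity only needs each to be adapted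
to the transported subspace. Invariance under the full product allows the frame to close up at time
`ℓ`. The predicate `P` carries a further condition, used for compatibility with `J`. -/
theorem exists_moving_frames {S : ℕ → Matrix n n ℝ} (hS : ∀ i, (S i).det ≠ 0) {ℓ : ℕ}
    {V : Submodule ℝ (n → ℝ)} (hV : ∀ v ∈ V, (matProd S ℓ).mulVec v ∈ V)
    {P : Matrix n (m ⊕ k) ℝ → Prop} (h : ∀ i, ∃ Q, IsFrame (transport S V i) Q ∧ P Q) :
    ∃ Q : ℕ → Matrix n (m ⊕ k) ℝ, (∀ i, IsFrame (transport S V i) (Q i)) ∧ (∀ i, P (Q i)) ∧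
      Q ℓ = Q 0 ∧ ∃ (A : ℕ → Matrix m m ℝ) (B : ℕ → Matrix m k ℝ) (D : ℕ → Matrix k k ℝ),
        ∀ i, (Q (i + 1)).transpose * S i * Q i =
        Matrix.fromBlocks (A i) (B i) 0 (D i) := by
  have hVℓ : transport S V ℓ = transport S V 0 := by
    have h0 : transport S V 0 = V := by simp [transport, matProd]
    rw [h0]
    refine Submodule.eq_of_le_of_finrank_eq ?_ (finrank_map_mulVecLin (det_matProd_ne_zero hS ℓ) V)
    rintro _ ⟨v, hv, rfl⟩
    exact hV v hv
  choose F hF hP using h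
  -- The frame at time `ℓ` is replaced by the initial one, which is adapted to the same subspace.
  set Q : ℕ → Matrix n (m ⊕ k) ℝ := fun i => if i = ℓ then F 0 else F i
  have hQ : ∀ i, IsFrame (transport S V i) (Q i) := by
    intro i
    by_cases hi : i = ℓ
    · simp only [Q, hi, if_true, hVℓ, hF]
    · simp only [Q, hi, if_false, hF]
  have hb : ∀ i, ∃ A B D, (Q (i + 1)).transpose * S i * Q i = Matrix.fromBlocks A B 0 D := by
    intro i
    refine (hQ i).exists_fromBlocks (hQ (i + 1)) ?_
    rintro _ ⟨v, hv, rfl⟩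
    refine ⟨v, hv, ?_⟩
    simp [matProd]
  choose A B D hABD using hb
  refine ⟨Q, hQ, fun i => ?_, ?_, A, B, D, hABD⟩
  · by_cases hi : i = ℓ
    · simp only [Q, hi, if_true, hP]
    · simp only [Q, hi, if_false, hP]
  · by_cases hi : 0 = ℓ <;> simp [Q, hi]

theorem det_ne_zero_of_frames {Q Q' : Matrix n (m ⊕ k) ℝ} {V V' : Submodule ℝ (n → ℝ)}
    (hQ : IsFrame V Q) (hQ' : IsFrame V' Q') {S : Matrix n n ℝ} (hS : S.det ≠ 0)
    {A : Matrix m m ℝ} {B : Matrix m k ℝ} {D : Matrix k k ℝ}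
    (h : Q'.transpose * S * Q = Matrix.fromBlocks A B 0 D) : A.det ≠ 0 ∧ D.det ≠ 0 := by
  have h1 : (Q'.transpose * S * Q) * (Q.transpose * S⁻¹ * Q') = 1 := by
    calc _ = Q'.transpose * (S * (Q * Q.transpose) * S⁻¹) * Q' := by
          simp only [Matrix.mul_assoc]
      _ = 1 := by
          rw [hQ.mul_transpose, Matrix.mul_one, Matrix.mul_nonsing_inv _ hS.isUnit, Matrix.mul_one,
            hQ'.transpose_mul]
  have h2 : (Q'.transpose * S * Q).det ≠ 0 := fun h0 => by
    have := congrArg Matrix.det h1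
    rw [Matrix.det_mul, h0, zero_mul, Matrix.det_one] at this
    exact zero_ne_one this
  rw [h, Matrix.det_fromBlocks_zero₂₁] at h2
  exact mul_ne_zero_iff.1 h2

theorem complexEigenvalues_matProd_of_frames {S : ℕ → Matrix n n ℝ} {Q : ℕ → Matrix n (m ⊕ k) ℝ}
    (h : ∀ i, (Q i).transpose * Q i = 1) (h' : ∀ i, Q i * (Q i).transpose = 1) {ℓ : ℕ}
    (hℓ : Q ℓ = Q 0) {A : ℕ → Matrix m m ℝ} {B : ℕ → Matrix m k ℝ} {D : ℕ → Matrix k k ℝ}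
    (hS : ∀ i, (Q (i + 1)).transpose * S i * Q i = Matrix.fromBlocks (A i) (B i) 0 (D i)) :
    complexEigenvalues (matProd S ℓ) =
      complexEigenvalues (matProd A ℓ) + complexEigenvalues (matProd D ℓ) := by
  simpa [blockConj_one (h' _)] using
    complexEigenvalues_matProd_blockConj h h' hℓ hS (fun _ => 1) (fun _ => 1)

end MovingFrames

/-! ### Induction on the dimension -/

/-- Rotation paths of the two diagonal blocks of a block-triangular sequence combine. -/
theorem isRotationPath_blockConj {n m k : Type*} [Fintype n] [DecidableEq n] [Fintype m]
    [DecidableEq m] [Fintype k] [DecidableEq k] {ε : ℝ}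
    {S : ℕ → Matrix n n ℝ} {Q : ℕ → Matrix n (m ⊕ k) ℝ}
    (h : ∀ i, (Q i).transpose * Q i = 1) (h' : ∀ i, Q i * (Q i).transpose = 1) {ℓ : ℕ}
    (hℓ : Q ℓ = Q 0) {A : ℕ → Matrix m m ℝ} {B : ℕ → Matrix m k ℝ} {D : ℕ → Matrix k k ℝ}
    (hS : ∀ i, (Q (i + 1)).transpose * S i * Q i = Matrix.fromBlocks (A i) (B i) 0 (D i))
    {F : unitInterval → ℕ → Matrix m m ℝ} {G : unitInterval → ℕ → Matrix k k ℝ}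
    (hF : IsRotationPath ε ℓ A F) (hG : IsRotationPath ε ℓ D G) :
    IsRotationPath ε ℓ S fun t i => blockConj (Q i) (F t i) (G t i) where
  continuous i := continuous_blockConj _ (hF.continuous i) (hG.continuous i)
  start i := by rw [hF.start, hG.start, blockConj_one (h' i)]
  orthogonal t i := blockConj_transpose_mul_self (h i) (h' i) (hF.orthogonal t i)
    (hG.orthogonal t i)
  det_eq_one t i := by
    rw [det_blockConj (h i) (h' i), hF.det_eq_one, hG.det_eq_one, mul_one]
  close t i := norm_blockConj_sub_one_le (h i) (h' i) (hF.close t i) (hG.close t i)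
  norm_eq t := by
    rw [complexEigenvalues_matProd_blockConj h h' hℓ hS,
      complexEigenvalues_matProd_of_frames h h' hℓ hS, Multiset.map_add, Multiset.map_add,
      hF.norm_eq, hG.norm_eq]
  real z hz := by
    rw [complexEigenvalues_matProd_blockConj h h' hℓ hS, Multiset.mem_add] at hz
    exact hz.elim (hF.real z) (hG.real z)

theorem im_eq_zero_of_mem_complexEigenvalues_fin_one {M : Matrix (Fin 1) (Fin 1) ℝ} {z : ℂ}
    (hz : z ∈ complexEigenvalues M) : z.im = 0 := by
  rw [complexEigenvalues, Matrix.charpoly, Matrix.det_fin_one, Matrix.charmatrix_apply_eq,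
    Polynomial.roots_X_sub_C, Multiset.mem_singleton] at hz
  rw [hz]
  simp

/-- Strong induction, splitting along an invariant subspace down to dimension at most 2. The same
`ε` and `ℓ` pass to both blocks, so the required period does not depend on `d`. -/
theorem exists_isRotationPath {ε : ℝ} (hε : 0 < ε) {ℓ : ℕ} (hℓ : Real.pi ≤ ℓ * ε) (d : ℕ)
    (S : ℕ → Matrix (Fin d) (Fin d) ℝ) (hS : ∀ i, (S i).det ≠ 0) :
    ∃ D, IsRotationPath ε ℓ S D := by
  induction d using Nat.strong_induction_on with
  | _ d ih =>
    rcases lt_or_ge d 3 with hd | hd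
    · interval_cases d
      · refine ⟨_, isRotationPath_one hε.le fun z hz => ?_⟩
        have h := card_complexEigenvalues (matProd S ℓ)
        rw [Fintype.card_fin, Multiset.card_eq_zero] at h
        rw [h] at hz
        exact absurd hz (Multiset.notMem_zero z)
      · exact ⟨_, isRotationPath_one hε.le fun z hz =>
          im_eq_zero_of_mem_complexEigenvalues_fin_one hz⟩
      · exact exists_isRotationPath_fin_two hS hε hℓ
    · obtain ⟨V, hV, hpos, hlt⟩ := exists_invariant_submodule (matProd S ℓ).mulVecLin
        (by simpa using hd)
      rw [Module.finrank_fintype_fun_eq_card, Fintype.card_fin] at hlt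
      obtain ⟨Q, hQ, -, hQℓ, A, B, D, hABD⟩ := exists_moving_frames (P := fun _ => True)
        (m := Fin (Module.finrank ℝ V)) (k := Fin (d - Module.finrank ℝ V)) hS hV fun i =>
          (exists_isFrame (transport S V i) (finrank_map_mulVecLin (det_matProd_ne_zero hS i) V)
            (by rw [Fintype.card_fin]; omega)).imp fun Q hQ => ⟨hQ, trivial⟩
      have hdet := fun i => det_ne_zero_of_frames (hQ i) (hQ (i + 1)) (hS i) (hABD i)
      obtain ⟨F, hF⟩ := ih _ hlt A fun i => (hdet i).1
      obtain ⟨G, hG⟩ := ih _ (by omega) D fun i => (hdet i).2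
      exact ⟨_, isRotationPath_blockConj (fun i => (hQ i).transpose_mul)
        (fun i => (hQ i).mul_transpose) hQℓ hABD hF hG⟩

/-! ### Invariant Lagrangian subspaces -/

section Lagrangian

open Polynomial

variable {E : Type*} [AddCommGroup E] [Module ℝ E] [FiniteDimensional ℝ E]

theorem two_mul_finrank_le_of_isotropic {B : LinearMap.BilinForm ℝ E} (hnd : B.Nondegenerate)
    {W : Submodule ℝ E} (hW : W ≤ B.orthogonal W) :
    2 * Module.finrank ℝ W ≤ Module.finrank ℝ E := by
  have h := Submodule.finrank_mono hW
  rw [LinearMap.BilinForm.finrank_orthogonal hnd] at h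
  have := Submodule.finrank_le W
  omega

/-- An isotropic invariant subspace which is not Lagrangian can be enlarged, when the map is
symplectic and has no nonreal eigenvalue of modulus one. -/
theorem exists_isotropic_invariant_gt {B : LinearMap.BilinForm ℝ E} (hnd : B.Nondegenerate)
    (halt : B.IsAlt) {f : E →ₗ[ℝ] E} (hf : ∀ x y, B (f x) (f y) = B x y)
    (hyp : ∀ a b : ℝ, Irreducible (X ^ 2 + C a * X + C b) →
      X ^ 2 + C a * X + C b ∣ f.charpoly → b ≠ 1)
    {W : Submodule ℝ E} (hW : ∀ x ∈ W, f x ∈ W) (hiso : ∀ x ∈ W, ∀ y ∈ W, B x y = 0)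
    (hlt : 2 * Module.finrank ℝ W < Module.finrank ℝ E) :
    ∃ W' : Submodule ℝ E, (∀ x ∈ W', f x ∈ W') ∧ (∀ x ∈ W', ∀ y ∈ W', B x y = 0) ∧ W < W' := by
  have hsymm : ∀ x y, B x y = -B y x := fun x y => (halt.neg_eq y x).symm
  have hinj : Function.Injective f := by
    rw [← LinearMap.ker_eq_bot, LinearMap.ker_eq_bot']
    intro x hx
    refine hnd.1 x fun y => ?_
    rw [← hf, hx, map_zero, LinearMap.zero_apply]
  -- Injectivity in finite dimension gives `f W = W`, which makes the orthogonal of `W` invariant.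
  have hsurj : ∀ w ∈ W, ∃ w' ∈ W, f w' = w := by
    have hmap : W.map f = W := by
      refine Submodule.eq_of_le_of_finrank_eq ?_
        (Submodule.equivMapOfInjective f hinj W).finrank_eq.symm
      rintro _ ⟨x, hx, rfl⟩
      exact hW x hx
    intro w hw
    rw [← hmap] at hw
    exact hw
  set U := B.orthogonal W with hUdef
  have hU : ∀ x, x ∈ U ↔ ∀ w ∈ W, B w x = 0 := fun x => Iff.rfl
  have hUf : ∀ x ∈ U, f x ∈ U := by
    intro x hx
    rw [hU] at hx ⊢
    intro w hw
    obtain ⟨w', hw', rfl⟩ := hsurj w hw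
    rw [hf, hx w' hw']
  have hWU : W < U := by
    refine lt_of_le_of_ne (fun x hx => (hU x).2 fun w hw => hiso w hw x hx) fun h => ?_
    have := LinearMap.BilinForm.finrank_orthogonal hnd W
    rw [← hUdef, ← h] at this
    omega
  obtain ⟨u, huU, huW⟩ := SetLike.exists_of_lt hWU
  obtain ⟨v, hvU, hvW, hrel⟩ := exists_low_degree_relation hUf huU huW
    (LinearMap.charpoly_monic f).ne_zero
    (by rw [LinearMap.aeval_self_charpoly, LinearMap.zero_apply]; exact W.zero_mem)
  have hvw : ∀ w ∈ W, B w v = 0 := (hU v).1 hvU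
  have hfvw : ∀ w ∈ W, B w (f v) = 0 := (hU _).1 (hUf v hvU)
  have hvv : ∀ x, B x x = 0 := halt
  -- The only pairing that could obstruct isotropy of `W + span {v, f v}`. In the quadratic case,
  -- pairing the relation with `f v` gives `(b - 1) * B v (f v) = 0`, and `b ≠ 1` by `hyp`.
  have hvfv : B v (f v) = 0 := by
    rcases hrel with ⟨c, hc⟩ | ⟨a, b, hab, hirr, hdvd⟩
    · have h := hvw _ hc
      rw [hsymm, map_sub, map_smul, hvv, smul_zero, sub_zero, neg_eq_zero] at h
      exact h
    · have h := hfvw _ hab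
      rw [map_add, map_add, map_smul, map_smul, LinearMap.add_apply, LinearMap.add_apply,
        LinearMap.smul_apply, LinearMap.smul_apply, hf, hvv, hsymm (f v) v] at h
      simp only [smul_eq_mul] at h
      have hb := hyp a b hirr hdvd
      have : (b - 1) * B v (f v) = 0 := by linarith
      exact (mul_eq_zero.1 this).resolve_left (sub_ne_zero.2 hb)
  set W' := W ⊔ Submodule.span ℝ {v, f v} with hW'
  have h0 : W ≤ W' := le_sup_left
  have h1 : v ∈ W' := Submodule.mem_sup_right (Submodule.subset_span (by simp))
  have h2 : f v ∈ W' := Submodule.mem_sup_right (Submodule.subset_span (by simp))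
  have h3 : f (f v) ∈ W' := by
    rcases hrel with ⟨c, hc⟩ | ⟨a, b, hab, -⟩
    · have : f (f v) = f (f v - c • v) + c • f v := by simp
      rw [this]
      exact W'.add_mem (h0 (hW _ hc)) (W'.smul_mem c h2)
    · have : f (f v) = (f (f v) + a • f v + b • v) - (a • f v + b • v) := by abel
      rw [this]
      exact W'.sub_mem (h0 hab) (W'.add_mem (W'.smul_mem a h2) (W'.smul_mem b h1))
  have hle : ∀ {T : Submodule ℝ E}, W ≤ T → v ∈ T → f v ∈ T → W' ≤ T := by
    intro T hT hv hfv
    rw [hW', sup_le_iff, Submodule.span_le]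
    refine ⟨hT, ?_⟩
    rintro y (rfl | rfl) <;> assumption
  refine ⟨W', fun x hx => ?_, ?_, lt_of_le_of_ne h0 fun h => hvW (h ▸ h1)⟩
  · exact hle (T := W'.comap f) (fun x hx => h0 (hW x hx)) h2 h3 hx
  · have key : ∀ x ∈ W', B v x = 0 ∧ B (f v) x = 0 ∧ ∀ w ∈ W, B w x = 0 := by
      intro x hx
      refine ⟨?_, ?_, fun w hw => ?_⟩
      · exact hle (T := LinearMap.ker (B v)) (fun w hw => by simp [hsymm v, hvw w hw])
          (hvv v) hvfv hx
      · exact hle (T := LinearMap.ker (B (f v))) (fun w hw => by simp [hsymm (f v), hfvw w hw])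
          (by simp [hsymm (f v), hvfv]) (hvv _) hx
      · exact hle (T := LinearMap.ker (B w)) (fun w' hw' => hiso w hw w' hw') (hvw w hw)
          (hfvw w hw) hx
    intro x hx y hy
    obtain ⟨k1, k2, k3⟩ := key y hy
    exact hle (T := LinearMap.ker (B.flip y)) (fun w hw => by simpa using k3 w hw)
      (by simpa using k1) (by simpa using k2) hx

/-- A maximal isotropic invariant subspace is Lagrangian, since otherwise it could be enlarged. -/
theorem exists_lagrangian_invariant {B : LinearMap.BilinForm ℝ E} (hnd : B.Nondegenerate)
    (halt : B.IsAlt) {f : E →ₗ[ℝ] E} (hf : ∀ x y, B (f x) (f y) = B x y)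
    (hyp : ∀ a b : ℝ, Irreducible (X ^ 2 + C a * X + C b) →
      X ^ 2 + C a * X + C b ∣ f.charpoly → b ≠ 1) :
    ∃ W : Submodule ℝ E, (∀ x ∈ W, f x ∈ W) ∧ (∀ x ∈ W, ∀ y ∈ W, B x y = 0) ∧
      2 * Module.finrank ℝ W = Module.finrank ℝ E := by
  obtain ⟨W, ⟨hW, hiso⟩, hmax⟩ := wellFounded_gt.has_min
    {W : Submodule ℝ E | (∀ x ∈ W, f x ∈ W) ∧ (∀ x ∈ W, ∀ y ∈ W, B x y = 0)}
    ⟨⊥, by simp, by simp⟩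
  refine ⟨W, hW, hiso, le_antisymm (two_mul_finrank_le_of_isotropic hnd
    fun x hx w hw => hiso w hw x hx) (not_lt.1 fun hlt => ?_)⟩
  obtain ⟨W', h1, h2, h3⟩ := exists_isotropic_invariant_gt hnd halt hf hyp hW hiso hlt
  exact hmax W' ⟨h1, h2⟩ h3

/-- The roots are nonreal conjugates with product `b`. Through this, hyperbolicity excludes `b = 1`.
-/
theorem exists_mem_norm_sq_eq_of_irreducible_dvd {n : Type*} [Fintype n] [DecidableEq n]
    {M : Matrix n n ℝ} {a b : ℝ} (hirr : Irreducible (X ^ 2 + C a * X + C b))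
    (hdvd : X ^ 2 + C a * X + C b ∣ M.charpoly) : ∃ z ∈ complexEigenvalues M, ‖z‖ ^ 2 = b := by
  set p : ℝ[X] := X ^ 2 + C a * X + C b with hp
  have hdeg : p.degree = 2 := by rw [hp]; compute_degree!
  have hdeg' : (p.map (algebraMap ℝ ℂ)).degree ≠ 0 := by rw [degree_map, hdeg]; norm_num
  obtain ⟨z, hz⟩ := IsAlgClosed.exists_root _ hdeg'
  have hz' : z ^ 2 + a * z + b = 0 := by simpa [hp, IsRoot] using hz
  have h1 := congrArg Complex.re hz'
  have h2 := congrArg Complex.im hz'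
  simp [sq] at h1 h2
  refine ⟨z, ?_, ?_⟩
  · rw [complexEigenvalues_eq_roots_map, mem_roots ((Matrix.charpoly_monic M).map _).ne_zero]
    exact hz.dvd (Polynomial.map_dvd _ hdvd)
  · have him : z.im ≠ 0 := by
      intro him
      rw [him] at h1
      have hroot : p.IsRoot z.re := by
        simp only [hp, IsRoot, eval_add, eval_pow, eval_X, eval_mul, eval_C]
        linarith
      have := degree_eq_one_of_irreducible_of_root hirr hroot
      rw [hdeg] at this
      norm_num at this
    have h3 : a = -(2 * z.re) := by
      have : z.im * (a + 2 * z.re) = 0 := by linarith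
      have := (mul_eq_zero.1 this).resolve_left him
      linarith
    rw [Complex.sq_norm, Complex.normSq_apply]
    rw [h3] at h1
    linarith

end Lagrangian

/-! ### The symplectic case -/

section Symplectic

open Matrix

variable {d : ℕ}

theorem transpose_mul_J_mul {S : Matrix (Fin d ⊕ Fin d) (Fin d ⊕ Fin d) ℝ}
    (hS : S ∈ symplecticGroup (Fin d) ℝ) : Sᵀ * J (Fin d) ℝ * S = J (Fin d) ℝ := by
  simpa using SymplecticGroup.mem_iff.1 (SymplecticGroup.transpose_mem hS)

theorem mulVec_dotProduct_J_mulVec {S : Matrix (Fin d ⊕ Fin d) (Fin d ⊕ Fin d) ℝ}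
    (hS : S ∈ symplecticGroup (Fin d) ℝ) (x y : Fin d ⊕ Fin d → ℝ) :
    (S *ᵥ x) ⬝ᵥ (J (Fin d) ℝ *ᵥ (S *ᵥ y)) = x ⬝ᵥ (J (Fin d) ℝ *ᵥ y) := by
  conv_rhs => rw [← transpose_mul_J_mul hS]
  rw [mulVec_mulVec, ← vecMul_transpose, ← dotProduct_mulVec, mulVec_mulVec, Matrix.mul_assoc]

theorem matProd_mem_symplecticGroup {S : ℕ → Matrix (Fin d ⊕ Fin d) (Fin d ⊕ Fin d) ℝ}
    (hS : ∀ i, S i ∈ symplecticGroup (Fin d) ℝ) (k : ℕ) :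
    matProd S k ∈ symplecticGroup (Fin d) ℝ := by
  induction k with
  | zero => exact one_mem _
  | succ k ih => exact mul_mem (hS k) ih

/-- A hyperbolic symplectic matrix has an invariant Lagrangian subspace. -/
theorem exists_lagrangian_of_hyperbolic {M : Matrix (Fin d ⊕ Fin d) (Fin d ⊕ Fin d) ℝ}
    (hM : M ∈ symplecticGroup (Fin d) ℝ) (hyp : ∀ z ∈ complexEigenvalues M, ‖z‖ ≠ 1) :
    ∃ W : Submodule ℝ (Fin d ⊕ Fin d → ℝ), (∀ x ∈ W, M *ᵥ x ∈ W) ∧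
      (∀ x ∈ W, ∀ y ∈ W, x ⬝ᵥ (J (Fin d) ℝ *ᵥ y) = 0) ∧ Module.finrank ℝ W = d := by
  set B : LinearMap.BilinForm ℝ (Fin d ⊕ Fin d → ℝ) := Matrix.toBilin' (J (Fin d) ℝ) with hB
  have hBd : ∀ x y, B x y = x ⬝ᵥ (J (Fin d) ℝ *ᵥ y) := fun x y => Matrix.toBilin'_apply' _ x y
  have hnd : B.Nondegenerate :=
    Matrix.nondegenerate_toBilin'_iff.2
      (Matrix.Nondegenerate.of_det_ne_zero (isUnit_det_J (Fin d) ℝ).ne_zero)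
  have halt : B.IsAlt := by
    intro x
    have : B x x = -B x x := by
      rw [hBd]
      conv_lhs => rw [dotProduct_mulVec, dotProduct_comm, ← mulVec_transpose, J_transpose,
        neg_mulVec, dotProduct_neg]
    linarith
  obtain ⟨W, h1, h2, h3⟩ := exists_lagrangian_invariant (f := M.toLin') hnd halt
    (fun x y => by
      rw [hBd, hBd, toLin'_apply, toLin'_apply, mulVec_dotProduct_J_mulVec hM])
    (fun a b hirr hdvd hb => by
      rw [Matrix.charpoly_toLin'] at hdvd
      obtain ⟨z, hz, hz'⟩ := exists_mem_norm_sq_eq_of_irreducible_dvd hirr hdvd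
      rw [hb] at hz'
      exact hyp z hz ((pow_eq_one_iff_of_nonneg (norm_nonneg z) two_ne_zero).1 hz'))
  refine ⟨W, fun x hx => h1 x hx, fun x hx y hy => by rw [← hBd]; exact h2 x hx y hy, ?_⟩
  rw [Module.finrank_fintype_fun_eq_card, Fintype.card_sum, Fintype.card_fin] at h3
  omega

/-- A Lagrangian subspace has an orthogonal frame commuting with `J`. -/
theorem exists_isFrame_of_lagrangian {W : Submodule ℝ (Fin d ⊕ Fin d → ℝ)}
    (hiso : ∀ x ∈ W, ∀ y ∈ W, x ⬝ᵥ (J (Fin d) ℝ *ᵥ y) = 0) (hW : Module.finrank ℝ W = d) :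
    ∃ Q : Matrix (Fin d ⊕ Fin d) (Fin d ⊕ Fin d) ℝ, IsFrame W Q ∧
      J (Fin d) ℝ * Q = Q * J (Fin d) ℝ := by
  obtain ⟨b, hbW, hb⟩ := exists_orthonormal_columns W hW
  have hJJ : ∀ x y : Fin d ⊕ Fin d → ℝ,
      (J (Fin d) ℝ *ᵥ x) ⬝ᵥ (J (Fin d) ℝ *ᵥ y) = x ⬝ᵥ y := by
    intro x y
    rw [← vecMul_transpose, ← dotProduct_mulVec, mulVec_mulVec, J_transpose, Matrix.neg_mul,
      J_squared, neg_neg, one_mulVec]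
  -- For Lagrangian `W`, `J` maps `W` onto its Euclidean orthogonal, so an orthonormal basis `b` of
  -- `W` is completed by `J b`. Commutation with `J` then reduces to `J² = -1`.
  set Q : Matrix (Fin d ⊕ Fin d) (Fin d ⊕ Fin d) ℝ :=
    Matrix.of fun i => Sum.elim (fun j => b j i) fun j => (J (Fin d) ℝ *ᵥ b j) i with hQ
  have h1 : Qᵀ * Q = 1 := by
    ext i j
    rw [Matrix.mul_apply]
    change (fun k => Q k i) ⬝ᵥ (fun k => Q k j) = _
    rcases i with i | i <;> rcases j with j | j
    · simpa [Matrix.one_apply, hQ] using hb i j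
    · simpa [hQ] using hiso _ (hbW i) _ (hbW j)
    · simpa [hQ] using (dotProduct_comm _ _).trans (hiso _ (hbW j) _ (hbW i))
    · simpa [Matrix.one_apply, hQ] using (hJJ _ _).trans (hb i j)
  refine ⟨Q, ⟨h1, mul_eq_one_comm.1 h1, hbW, fun j v hv => hiso v hv _ (hbW j)⟩, ?_⟩
  have hcol : ∀ (T : Matrix (Fin d ⊕ Fin d) (Fin d ⊕ Fin d) ℝ) i j,
      (T * Q) i j = (T *ᵥ fun k => Q k j) i := fun T i j => rfl
  ext i j
  rw [hcol]
  rcases j with j | j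
  · simp [Matrix.mul_apply, J, hQ, Fintype.sum_sum_type, Matrix.one_apply]
  · have : (fun k => Q k (Sum.inr j)) = J (Fin d) ℝ *ᵥ b j := rfl
    rw [this, mulVec_mulVec, J_squared]
    simp [Matrix.mul_apply, J, hQ, Fintype.sum_sum_type, Matrix.one_apply, neg_mulVec]

/-- An orthogonal matrix commuting with `J` is symplectic. Using the same `F` in both blocks gives
the commutation. -/
theorem blockConj_mem_symplecticGroup {Q : Matrix (Fin d ⊕ Fin d) (Fin d ⊕ Fin d) ℝ}
    (h : Qᵀ * Q = 1) (h' : Q * Qᵀ = 1) (hJ : J (Fin d) ℝ * Q = Q * J (Fin d) ℝ)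
    {F : Matrix (Fin d) (Fin d) ℝ} (hF : Fᵀ * F = 1) :
    blockConj Q F F ∈ symplecticGroup (Fin d) ℝ := by
  have hJ' : J (Fin d) ℝ * Qᵀ = Qᵀ * J (Fin d) ℝ := by
    have := congrArg transpose hJ
    simp only [transpose_mul, J_transpose, Matrix.mul_neg, Matrix.neg_mul, neg_inj] at this
    exact this.symm
  have hJF : J (Fin d) ℝ * fromBlocks F 0 0 F = fromBlocks F 0 0 F * J (Fin d) ℝ := by
    simp [J, fromBlocks_multiply]
  have hcomm : blockConj Q F F * J (Fin d) ℝ = J (Fin d) ℝ * blockConj Q F F := by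
    rw [blockConj, Matrix.mul_assoc, ← hJ', ← Matrix.mul_assoc, Matrix.mul_assoc Q, ← hJF,
      ← Matrix.mul_assoc, ← hJ]
    simp only [Matrix.mul_assoc]
  rw [SymplecticGroup.mem_iff, hcomm, Matrix.mul_assoc,
    mul_eq_one_comm.1 (blockConj_transpose_mul_self h h' hF hF), Matrix.mul_one]

theorem transpose_mul_eq_one_of_fromBlocks {A B D : Matrix (Fin d) (Fin d) ℝ}
    (h : (fromBlocks A B 0 D)ᵀ * J (Fin d) ℝ * fromBlocks A B 0 D = J (Fin d) ℝ) :
    Aᵀ * D = 1 := by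
  rw [J, fromBlocks_transpose, fromBlocks_multiply, fromBlocks_multiply, fromBlocks_inj] at h
  simpa using h.2.1

/-- An orthogonal `F i` is its own inverse transpose, so the same twist on both blocks keeps them
inverse transposes. -/
theorem matProd_transpose_mul_matProd {A D F : ℕ → Matrix (Fin d) (Fin d) ℝ}
    (hAD : ∀ i, (A i)ᵀ * D i = 1) (hF : ∀ i, (F i)ᵀ * F i = 1) (k : ℕ) :
    (matProd (fun i => A i * F i) k)ᵀ * matProd (fun i => D i * F i) k = 1 := by
  induction k with
  | zero => simp [matProd]
  | succ k ih =>
    rw [matProd, matProd]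
    simp only [transpose_mul]
    calc _ = (matProd (fun i => A i * F i) k)ᵀ * ((F k)ᵀ * ((A k)ᵀ * D k) * F k) *
          matProd (fun i => D i * F i) k := by simp only [Matrix.mul_assoc]
      _ = 1 := by rw [hAD, Matrix.mul_one, hF, Matrix.mul_one, ih]

theorem complexEigenvalues_of_transpose_mul_eq_one {n : Type*} [Fintype n] [DecidableEq n]
    {P R : Matrix n n ℝ} (h : Pᵀ * R = 1) :
    complexEigenvalues R = (complexEigenvalues P).map fun z => z⁻¹ := by
  have hP : IsUnit Pᵀ := IsUnit.of_mul_eq_one _ h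
  rw [← complexEigenvalues_transpose P, ← complexEigenvalues_inv _ hP, inv_eq_right_inv h]

/-- The general result is applied to the block `A` on the Lagrangian only. The other block has the
inverse eigenvalues throughout, so it inherits constant moduli and final reality. -/
theorem exists_isRotationPath_symplectic {ε : ℝ} (hε : 0 < ε) {ℓ : ℕ} (hℓ : Real.pi ≤ ℓ * ε)
    (S : ℕ → Matrix (Fin d ⊕ Fin d) (Fin d ⊕ Fin d) ℝ)
    (hS : ∀ i, S i ∈ symplecticGroup (Fin d) ℝ)
    (hyp : ∀ z ∈ complexEigenvalues (matProd S ℓ), ‖z‖ ≠ 1) :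
    ∃ D, IsRotationPath ε ℓ S D ∧ ∀ t i, D t i ∈ symplecticGroup (Fin d) ℝ := by
  have hdet : ∀ i, (S i).det ≠ 0 := fun i => (SymplecticGroup.symplectic_det (hS i)).ne_zero
  obtain ⟨W, hW, hiso, hrank⟩ :=
    exists_lagrangian_of_hyperbolic (matProd_mem_symplecticGroup hS ℓ) hyp
  obtain ⟨Q, hQ, hQJ, hQℓ, A, B, D, hABD⟩ := exists_moving_frames
    (P := fun Q => J (Fin d) ℝ * Q = Q * J (Fin d) ℝ) hdet hW fun i => by
      refine exists_isFrame_of_lagrangian ?_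
        ((finrank_map_mulVecLin (det_matProd_ne_zero hdet i) W).trans hrank)
      rintro _ ⟨x, hx, rfl⟩ _ ⟨y, hy, rfl⟩
      exact (mulVec_dotProduct_J_mulVec (matProd_mem_symplecticGroup hS i) x y).trans
        (hiso x hx y hy)
  have hAdet := fun i => (det_ne_zero_of_frames (hQ i) (hQ (i + 1)) (hdet i) (hABD i)).1
  have hAD : ∀ i, (A i)ᵀ * D i = 1 := by
    intro i
    apply transpose_mul_eq_one_of_fromBlocks (B := B i)
    rw [← hABD i]
    calc _ = (Q i)ᵀ * ((S i)ᵀ * (Q (i + 1) * J (Fin d) ℝ * (Q (i + 1))ᵀ) * S i) * Q i := by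
          simp only [transpose_mul, transpose_transpose, Matrix.mul_assoc]
      _ = (Q i)ᵀ * ((S i)ᵀ * J (Fin d) ℝ * S i) * Q i := by
          rw [← hQJ, Matrix.mul_assoc (J (Fin d) ℝ), (hQ (i + 1)).mul_transpose, Matrix.mul_one]
      _ = J (Fin d) ℝ := by
          rw [transpose_mul_J_mul (hS i), Matrix.mul_assoc, hQJ, ← Matrix.mul_assoc,
            (hQ i).transpose_mul, Matrix.one_mul]
  obtain ⟨F, hF⟩ := exists_isRotationPath hε hℓ d A hAdet
  have hinv : ∀ t, complexEigenvalues (matProd (fun i => D i * F t i) ℓ) =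
      (complexEigenvalues (matProd (fun i => A i * F t i) ℓ)).map fun z => z⁻¹ := fun t =>
    complexEigenvalues_of_transpose_mul_eq_one
      (matProd_transpose_mul_matProd hAD (hF.orthogonal t) ℓ)
  have hnorm : ∀ t, (complexEigenvalues (matProd (fun i => D i * F t i) ℓ)).map (fun z => ‖z‖) =
      ((complexEigenvalues (matProd (fun i => A i * F t i) ℓ)).map (fun z => ‖z‖)).map
        fun x => x⁻¹ := by
    intro t
    rw [hinv, Multiset.map_map, Multiset.map_map]
    simp
  have hG : IsRotationPath ε ℓ D F :=
    { continuous := hF.continuous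
      start := hF.start
      orthogonal := hF.orthogonal
      det_eq_one := hF.det_eq_one
      close := hF.close
      norm_eq := fun t => by
        have h0 := hnorm 0
        simp only [hF.start, Matrix.mul_one] at h0
        rw [hnorm, hF.norm_eq, h0]
      real := fun z hz => by
        rw [hinv] at hz
        obtain ⟨y, hy, rfl⟩ := Multiset.mem_map.1 hz
        simp [hF.real y hy] }
  exact ⟨_, isRotationPath_blockConj (fun i => (hQ i).transpose_mul)
    (fun i => (hQ i).mul_transpose) hQℓ hABD hF hG, fun t i =>
    blockConj_mem_symplecticGroup (hQ i).transpose_mul (hQ i).mul_transpose (hQJ i)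
      (hF.orthogonal t i)⟩

end Symplectic

/-! ### From rotation paths to perturbations of cocycles -/

section Cocycles

variable {n : Type*} [Fintype n] [DecidableEq n] {G : Subgroup (Matrix.GeneralLinearGroup n ℝ)}
  {ℓ : ℕ}

theorem PeriodicCocycle.norm_le (A : PeriodicCocycle G ℓ) {C : ℝ} (hA : A.IsBoundedBy C) (i : ℤ) :
    max ‖(A.toFun i).val‖ ‖((A.toFun i)⁻¹).val‖ ≤ C := by
  have hℓ : (0 : ℤ) < ℓ := by exact_mod_cast A.one_le_period
  have hper : Function.Periodic A.toFun (ℓ : ℤ) := A.periodic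
  have h : A.toFun i = A.toFun ((i - 1) % ℓ + 1) := by
    have e : i = (i - 1) % ℓ + 1 + (i - 1) / ℓ * ℓ := by
      have := Int.emod_add_mul_ediv (i - 1) ℓ
      linarith
    conv_lhs => rw [e]
    exact hper.int_mul _ _
  rw [h]
  exact hA _ (by linarith [Int.emod_nonneg (i - 1) hℓ.ne'])
    (by linarith [Int.emod_lt_of_pos (i - 1) hℓ])

/-- An orthogonal matrix as an element of the general linear group. -/
def orthogonalUnit (D : Matrix n n ℝ) (h : D.transpose * D = 1) : Matrix.GeneralLinearGroup n ℝ :=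
  ⟨D, D.transpose, mul_eq_one_comm.1 h, h⟩

/-- Right multiplication by `D` moves `A i` by `A i (1 - D)` and its inverse by `(1 - Dᵀ) (A i)⁻¹`;
both have norm at most `C * δ`. -/
theorem PeriodicCocycle.canBeMadeReal_of_isRotationPath (A : PeriodicCocycle G ℓ) {C ε δ : ℝ}
    (hA : A.IsBoundedBy C) (hδ : C * δ < ε) {D : unitInterval → ℕ → Matrix n n ℝ}
    (hD : IsRotationPath δ ℓ (fun i => (A.toFun (i + 1)).val) D)
    (hG : ∀ t i, orthogonalUnit (D t i) (hD.orthogonal t i) ∈ G) : A.CanBeMadeReal ε := by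
  set u : unitInterval → ℕ → Matrix.GeneralLinearGroup n ℝ :=
    fun t i => orthogonalUnit (D t i) (hD.orthogonal t i) with hu
  -- Cocycle indices `1, …, ℓ` correspond to sequence indices `0, …, ℓ - 1`; the residue extends the
  -- rotations periodically.
  set idx : ℤ → ℕ := fun i => ((i - 1) % ℓ).toNat with hidx
  let γ : unitInterval → PeriodicCocycle G ℓ := fun t =>
    { toFun := fun i => A.toFun i * u t (idx i)
      one_le_period := A.one_le_period
      mem := fun i => G.mul_mem (A.mem i) (hG t _)
      periodic := fun i => by
        have : i + ℓ - 1 = i - 1 + ℓ := by ring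
        simp only [hidx, A.periodic, this, Int.add_emod_right] }
  have hprod : ∀ t, (γ t).product = matProd (fun i => (A.toFun (i + 1)).val * D t i) ℓ := by
    intro t
    have h : ∀ k ≤ ℓ, (orderedProd (γ t).toFun k).val =
        matProd (fun i => (A.toFun (i + 1)).val * D t i) k := by
      intro k
      induction k with
      | zero => intro _; rfl
      | succ k ih =>
        intro hk
        have e : idx (k + 1) = k := by
          rw [hidx]
          simp only [add_sub_cancel_right]
          rw [Int.emod_eq_of_lt (by positivity) (by exact_mod_cast hk), Int.toNat_natCast]
        rw [orderedProd, Units.val_mul, ih (by omega), matProd]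
        change (A.toFun (k + 1)).val * D t (idx (k + 1)) * _ = _
        rw [e]
    exact h ℓ le_rfl
  have hclose : ∀ t i, ‖1 - D t i‖ ≤ δ := fun t i => by rw [norm_sub_rev]; exact hD.close t i
  have hC : ∀ i, ‖(A.toFun i).val‖ ≤ C ∧ ‖((A.toFun i)⁻¹).val‖ ≤ C := fun i =>
    max_le_iff.1 (A.norm_le hA i)
  refine ⟨γ, ⟨fun i => ?_, ?_, fun t i => ?_⟩, fun s t => ?_, fun z hz => ?_⟩
  · exact continuous_const.matrix_mul (hD.continuous (idx i))
  · have h1 : ∀ i, u 0 i = 1 := fun i => Units.ext (hD.start i)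
    simp only [γ, h1, mul_one]
  · have hC0 : 0 ≤ C := (norm_nonneg _).trans (hC i).1
    refine max_lt (lt_of_le_of_lt ?_ hδ) (lt_of_le_of_lt ?_ hδ)
    · change ‖(A.toFun i).val - (A.toFun i).val * D t (idx i)‖ ≤ _
      rw [← mul_one_sub]
      exact (norm_mul_le _ _).trans (mul_le_mul (hC i).1 (hclose _ _) (norm_nonneg _) hC0)
    · change ‖((A.toFun i)⁻¹).val - ((A.toFun i * u t (idx i))⁻¹).val‖ ≤ _
      rw [mul_inv_rev, Units.val_mul]
      change ‖_ - (D t (idx i)).transpose * _‖ ≤ _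
      rw [← one_sub_mul]
      have h1 : ‖1 - (D t (idx i)).transpose‖ ≤ δ := by
        have e : 1 - (D t (idx i)).transpose = (1 - D t (idx i)).conjTranspose := by
          rw [Matrix.conjTranspose_eq_transpose_of_trivial, Matrix.transpose_sub,
            Matrix.transpose_one]
        rw [e, Matrix.l2_opNorm_conjTranspose]
        exact hclose _ _
      rw [mul_comm C]
      exact (norm_mul_le _ _).trans
        (mul_le_mul h1 (hC i).2 (norm_nonneg _) ((norm_nonneg _).trans h1))
  · rw [hprod, hprod, hD.norm_eq, hD.norm_eq]
  · rw [hprod] at hz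
    exact hD.real z hz

theorem pi_le_mul_of_ceil_le {δ : ℝ} (hδ : 0 < δ) {ℓ : ℕ} (hℓ : ⌈Real.pi / δ⌉₊ + 1 ≤ ℓ) :
    Real.pi ≤ ℓ * δ := by
  rw [← div_le_iff₀ hδ]
  exact (Nat.le_ceil _).trans (by exact_mod_cast (Nat.le_succ _).trans hℓ)

end Cocycles

/-! ### The main theorem -/

theorem mainTheorem8 :
    (∀ d₀ : ℕ, 1 ≤ d₀ → ∀ C : ℝ, 1 < C → ∀ ε : ℝ, 0 < ε → ∃ T : ℕ, 1 ≤ T ∧ ∀ ℓ : ℕ, T ≤ ℓ →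
      (∀ A : PeriodicCocycle (⊤ : Subgroup (Matrix.GeneralLinearGroup (Fin d₀) ℝ)) ℓ,
        A.IsBoundedBy C → A.CanBeMadeReal ε) ∧
      (∀ A : PeriodicCocycle (slSubgroup (Fin d₀)) ℓ,
        A.IsBoundedBy C → A.CanBeMadeReal ε)) ∧
    (∀ d : ℕ, 1 ≤ d → ∀ C : ℝ, 1 < C → ∀ ε : ℝ, 0 < ε → ∃ T : ℕ, 1 ≤ T ∧ ∀ ℓ : ℕ, T ≤ ℓ →
      ∀ A : PeriodicCocycle (spSubgroup d) ℓ,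
        A.IsBoundedBy C → A.IsHyperbolic → A.CanBeMadeReal ε) := by
  -- Rotation paths are close in the weak sense `≤ δ`; halving `ε / C` yields the strict bound.
  have hsmall : ∀ C ε : ℝ, 1 < C → 0 < ε → 0 < ε / (2 * C) ∧ C * (ε / (2 * C)) < ε := by
    intro C ε hC hε
    have hC0 : 0 < C := by linarith
    refine ⟨by positivity, ?_⟩
    have : C * (ε / (2 * C)) = ε / 2 := by field_simp
    linarith
  have hunit : ∀ {n : Type} [Fintype n] [DecidableEq n] (g : Matrix.GeneralLinearGroup n ℝ),
      g.val.det ≠ 0 := fun g => ((Matrix.isUnit_iff_isUnit_det _).1 g.isUnit).ne_zero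
  refine ⟨fun d₀ _ C hC ε hε => ?_, fun d _ C hC ε hε => ?_⟩
  · obtain ⟨hδ, hδε⟩ := hsmall C ε hC hε
    -- The planar case needs `π ≤ ℓ δ` with `δ = ε / (2 * C)`; the added 1 makes `1 ≤ T` immediate.
    refine ⟨⌈Real.pi / (ε / (2 * C))⌉₊ + 1, by omega, fun ℓ hℓ => ⟨fun A hA => ?_, fun A hA => ?_⟩⟩
    · obtain ⟨D, hD⟩ := exists_isRotationPath hδ (pi_le_mul_of_ceil_le hδ hℓ) d₀
        (fun i => (A.toFun (i + 1)).val) fun i => hunit _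
      exact A.canBeMadeReal_of_isRotationPath hA hδε hD fun t i => Subgroup.mem_top _
    · obtain ⟨D, hD⟩ := exists_isRotationPath hδ (pi_le_mul_of_ceil_le hδ hℓ) d₀
        (fun i => (A.toFun (i + 1)).val) fun i => hunit _
      refine A.canBeMadeReal_of_isRotationPath hA hδε hD fun t i => ?_
      exact MonoidHom.mem_ker.2 (Units.ext (hD.det_eq_one t i))
  · obtain ⟨hδ, hδε⟩ := hsmall C ε hC hε
    refine ⟨⌈Real.pi / (ε / (2 * C))⌉₊ + 1, by omega, fun ℓ hℓ A hA hyp => ?_⟩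
    have hprod : ∀ k, (orderedProd A.toFun k).val =
        matProd (fun i => (A.toFun (i + 1)).val) k := by
      intro k
      induction k with
      | zero => rfl
      | succ k ih => rw [orderedProd, Units.val_mul, ih, matProd]
    obtain ⟨D, hD, hDmem⟩ := exists_isRotationPath_symplectic hδ (pi_le_mul_of_ceil_le hδ hℓ)
      (fun i => (A.toFun (i + 1)).val)
      (fun i => by
        obtain ⟨s, hs⟩ := A.mem (i + 1)
        rw [← hs]
        exact s.2)
      (fun z hz => hyp z (by rw [PeriodicCocycle.product, hprod]; exact hz))
    exact A.canBeMadeReal_of_isRotationPath hA hδε hD fun t i =>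
      ⟨⟨D t i, hDmem t i⟩, Units.ext rfl⟩
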